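/- Let $k$ be a field and let $\mathcal C$ be a braided monoidal category, with braiding $\Psi$, whose objects have underlying $k$-vector spaces compatibly with tensor products: there is a strong monoidal functor from $\mathcal C$ to $k$-vector spaces, which need not preserve the braiding (for example, the modules over a quasitriangular Hopf algebra, or the comodules over a coquasitriangular one). Let $X$ be a finite-dimensional braided Hopf algebra, that is, a Hopf algebra object in $\mathcal C$ that has a dual object $D$ with evaluation $\langle\cdot,\cdot\rangle: D\otimes X\to k$ and canonical element $\sum_i\phi^i\otimes\epsilon_i\in X\otimes D$, both morphisms of $\mathcal C$. Let $D$ be a braided Hopf algebra with invertible antipode $S$, dual to $X$ in the sense that $$\langle\sigma\tau,\xi\rangle=\langle\sigma,\xi_{(2)}\rangle\langle\tau,\xi_{(1)}\rangle,\quad \langle\sigma,\xi\eta\rangle=\langle\sigma_{(1)},\eta\rangle\langle\sigma_{(2)},\xi\rangle,\quad \langle 1,\xi\rangle=\epsilon(\xi),\quad \langle\sigma,1\rangle=\epsilon(\sigma).$$ Write $\sum_i\epsilon_i'\otimes\phi_i'=\Psi_{D,X}^{-1}\big(\sum_i\phi^i\otimes\epsilon_i\big)\in D\otimes X$ for the image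 of the canonical element under the inverse of $\Psi_{D,X}:D\otimes X\to X\otimes D$, and define the braided integral $I:X\to X$ by the braided modified trace formula $$I(\xi)=\sum_i\big\langle S^{-2}(\epsilon_i'),(\phi_i'\xi)_{(1)}\big\rangle\,(\phi_i'\xi)_{(2)} .$$ Then $I$ is nontrivial, i.e. $I\neq0$ on the underlying vector space of $X$. Moreover $I$ takes values in the multiples of a right delta function: there are a nonzero right invariant integral $R:D\to k$ (that is, $R$ is linear and $R(\sigma_{(1)})\sigma_{(2)}=R(\sigma)1_D$), the element $\delta^R_X\in X$ with $\langle\sigma,\delta^R_X\rangle=R(\sigma)$ for all $\sigma\in D$, and a nonzero left invariant integral $L:X\to k$ (that is, $L$ is linear and $\xi_{(1)}L(\xi_{(2)})=L(\xi)1_X$) such that $I(\xi)=L(\xi)\,\delta^R_X$ for all $\xi\in X$. -/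

import Mathlib

open CategoryTheory MonoidalCategory
open scoped MonObj ComonObj HopfObj TensorProduct

universe u v w

namespace BraidedIntegral

section Diagrams

variable {C : Type w} [Category.{v} C] [MonoidalCategory C]

/-- The nested pairing `(σ ⊗ τ) ⊗ (x ⊗ y) ↦ ⟨σ, y⟩ ⟨τ, x⟩` of `D ⊗ D` with `X ⊗ X`. -/
def nestedEval (X D : C) [ExactPairing X D] : (D ⊗ D) ⊗ (X ⊗ X) ⟶ 𝟙_ C :=
  (α_ D D (X ⊗ X)).hom ≫ D ◁ (α_ D X X).inv ≫ D ◁ (ε_ X D ▷ X) ≫ D ◁ (λ_ X).hom ≫ ε_ X D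

/-- The action `σ ⊗ x ↦ ⟨σ, x₍₁₎⟩ x₍₂₎` of `D` on `X`. -/
def action (X D : C) [ComonObj X] [ExactPairing X D] : D ⊗ X ⟶ X :=
  D ◁ Δ[X] ≫ (α_ D X X).inv ≫ ε_ X D ▷ X ≫ (λ_ X).hom

variable [BraidedCategory C]

/-- Hopf objects `X` and `D` in a braided category, in exact duality as objects (evaluation
`D ⊗ X ⟶ 𝟙`, canonical element `𝟙 ⟶ X ⊗ D`), are dual as braided Hopf algebras: the product of
each is paired with the coproduct of the other, without any crossing, so
`⟨σ τ, x⟩ = ⟨σ, x₍₂₎⟩ ⟨τ, x₍₁₎⟩` and `⟨σ, x y⟩ = ⟨σ₍₁₎, y⟩ ⟨σ₍₂₎, x⟩`. -/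
structure IsHopfDual (X D : C) [HopfObj X] [HopfObj D] [ExactPairing X D] : Prop where
  mul_pair : μ[D] ▷ X ≫ ε_ X D = (D ⊗ D) ◁ Δ[X] ≫ nestedEval X D
  pair_mul : D ◁ μ[X] ≫ ε_ X D = Δ[D] ▷ (X ⊗ X) ≫ nestedEval X D
  one_pair : η[D] ▷ X ≫ ε_ X D = (λ_ X).hom ≫ ε[X]
  pair_one : D ◁ η[X] ≫ ε_ X D = (ρ_ D).hom ≫ ε[D]

/-- The canonical element of `X ⊗ D` moved to `D ⊗ X` by the inverse of the braiding
`D ⊗ X ⟶ X ⊗ D`. -/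
def twistedCoev (X D : C) [ExactPairing X D] : 𝟙_ C ⟶ D ⊗ X :=
  η_ X D ≫ (β_ D X).inv

/-- The braided integral, given by the braided modified trace formula: if `∑ ε' ⊗ φ' ∈ D ⊗ X` is
the image of the canonical element under the inverse braiding, then `x` is sent to
`∑ ⟨S⁻² ε', (φ' x)₍₁₎⟩ (φ' x)₍₂₎`. -/
noncomputable def braidedIntegral (X D : C) [HopfObj X] [HopfObj D] [ExactPairing X D]
    [IsIso 𝒮[D]] : X ⟶ X :=
  (λ_ X).inv ≫ twistedCoev X D ▷ X ≫ (α_ D X X).hom ≫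
    inv (𝒮[D] ≫ 𝒮[D]) ▷ (X ⊗ X) ≫ D ◁ μ[X] ≫ action X D

end Diagrams

section Underlying

variable {k : Type u} [Field k] {C : Type w} [Category.{v} C] [MonoidalCategory C]
  (F : C ⥤ ModuleCat.{u} k) [F.Monoidal]

/-- The coproduct on the underlying vector space. -/
def comulLin (X : C) [ComonObj X] : F.obj X →ₗ[k] F.obj X ⊗[k] F.obj X :=
  (F.map Δ[X] ≫ Functor.OplaxMonoidal.δ F X X).hom

/-- The unit element of the underlying vector space. -/
def oneElt (X : C) [MonObj X] : F.obj X :=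
  (Functor.LaxMonoidal.ε F ≫ F.map η[X]).hom (1 : k)

/-- The pairing `⟨σ, x⟩` on the underlying vector spaces. -/
def pairing (X D : C) [ExactPairing X D] : F.obj D →ₗ[k] F.obj X →ₗ[k] k :=
  TensorProduct.curry
    (Functor.LaxMonoidal.μ F D X ≫ F.map (ε_ X D) ≫ Functor.OplaxMonoidal.η F).hom

/-- A (numerical) left invariant integral on `X`: `x₍₁₎ L(x₍₂₎) = L(x) 1`. -/
def IsLeftIntegral (X : C) [MonObj X] [ComonObj X] (L : F.obj X →ₗ[k] k) : Prop :=
  ∀ x : F.obj X,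
    TensorProduct.rid k (F.obj X) (L.lTensor (F.obj X) (comulLin F X x)) = L x • oneElt F X

/-- A (numerical) right invariant integral on `D`: `R(σ₍₁₎) σ₍₂₎ = R(σ) 1`. -/
def IsRightIntegral (D : C) [MonObj D] [ComonObj D] (R : F.obj D →ₗ[k] k) : Prop :=
  ∀ s : F.obj D,
    TensorProduct.lid k (F.obj D) (R.rTensor (F.obj D) (comulLin F D s)) = R s • oneElt F D

/-- `δ ∈ X` is the right delta function that implements the nonzero right invariant integral
`R` on the dual `D`: `⟨σ, δ⟩ = R(σ)`. -/
def IsRightDelta (X D : C) [ExactPairing X D] [MonObj D] [ComonObj D]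
    (R : F.obj D →ₗ[k] k) (δ : F.obj X) : Prop :=
  IsRightIntegral F D R ∧ R ≠ 0 ∧ ∀ s : F.obj D, pairing F X D s δ = R s

end Underlying

end BraidedIntegral

/-!
With respect to the inverse braiding, the co-opposite of `D` is a Hopf algebra with antipode `S⁻¹`,
and `X` is a right Hopf module over it: `D` acts by `S⁻¹` followed by the regular action, and the
coaction multiplies by the canonical element. The braided modified trace formula is exactly the
standard projection `m ↦ m₍₀₎ S(m₍₁₎)` of this Hopf module onto its coinvariants. By the fundamental
theorem of Hopf modules, `X` is isomorphic to `im I ⊗ D`, and since `dim X = dim D` the projection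
`I = L(-) δ` has rank one. The projection turns the action into the counit, which makes `L` a left
integral, and its values are coinvariant, which makes `δ` a right delta function.
-/

namespace BraidedIntegral

section HopfModules

variable {C : Type w} [Category.{v} C] [MonoidalCategory C]

/-- `a` is a right action on `M` of the monoid `H`. -/
structure IsRightAction {M H : C} [MonObj H] (a : M ⊗ H ⟶ M) : Prop where
  one : M ◁ η[H] ≫ a = (ρ_ M).hom
  assoc : a ▷ H ≫ a = (α_ M H H).hom ≫ M ◁ μ[H] ≫ a

/-- `c` is a right coaction on `M` of the comonoid `H`. -/
structure IsRightCoaction {M H : C} [ComonObj H] (c : M ⟶ M ⊗ H) : Prop where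
  counit : c ≫ M ◁ ε[H] = (ρ_ M).inv
  coassoc : c ≫ c ▷ H = c ≫ M ◁ Δ[H] ≫ (α_ M H H).inv

lemma isRightAction_mul (H : C) [MonObj H] : IsRightAction μ[H] where
  one := MonObj.mul_one H
  assoc := MonObj.mul_assoc H

lemma isRightCoaction_comul (H : C) [ComonObj H] : IsRightCoaction Δ[H] where
  counit := ComonObj.comul_counit H
  coassoc := ComonObj.comul_assoc_flip H

section Convolution

variable {M N H : C} [MonObj H] [ComonObj H]

/-- The convolution `n ↦ f(n₍₀₎) s(n₍₁₎)` of `f : N ⟶ M` with an endomorphism `s` of `H`: a right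
action of the convolution monoid of `H` on the morphisms from a comodule `N` to a module `M`. -/
def convolve (c : N ⟶ N ⊗ H) (a : M ⊗ H ⟶ M) (f : N ⟶ M) (s : H ⟶ H) : N ⟶ M :=
  c ≫ f ▷ H ≫ M ◁ s ≫ a

variable {c : N ⟶ N ⊗ H} {a : M ⊗ H ⟶ M}

lemma convolve_counit_one (hc : IsRightCoaction c) (ha : IsRightAction a) (f : N ⟶ M) :
    convolve c a f (ε[H] ≫ η[H]) = f := by
  rw [convolve, whiskerLeft_comp_assoc, ha.one, ← whisker_exchange_assoc,
    reassoc_of% hc.counit, rightUnitor_naturality, Iso.inv_hom_id_assoc]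

lemma convolve_convolve (hc : IsRightCoaction c) (ha : IsRightAction a) (f : N ⟶ M)
    (s t : H ⟶ H) :
    convolve c a (convolve c a f s) t = convolve c a f (Δ[H] ≫ (s ⊗ₘ t) ≫ μ[H]) := by
  simp only [convolve, comp_whiskerRight, Category.assoc, whiskerLeft_comp]
  rw [reassoc_of% hc.coassoc, ← whisker_exchange_assoc, ha.assoc]
  simp [MonoidalCategory.tensorHom_def, ← whisker_exchange_assoc]

end Convolution

variable [BraidedCategory C]

/-- The diagonal action `(m ⊗ n) ⊗ h ↦ m h₍₁₎ ⊗ n h₍₂₎`, with `n` and `h₍₁₎` exchanged by the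
braiding. -/
def tensorAction {M N H : C} [ComonObj H] (a : M ⊗ H ⟶ M) (b : N ⊗ H ⟶ N) :
    (M ⊗ N) ⊗ H ⟶ M ⊗ N :=
  (M ⊗ N) ◁ Δ[H] ≫ tensorμ M N H H ≫ (a ⊗ₘ b)

/-- The codiagonal coaction `m ⊗ n ↦ (m₍₀₎ ⊗ n₍₀₎) ⊗ m₍₁₎ n₍₁₎`, with `m₍₁₎` and `n₍₀₎` exchanged
by the braiding. -/
def tensorCoaction {M N H : C} [MonObj H] (c : M ⟶ M ⊗ H) (d : N ⟶ N ⊗ H) :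
    M ⊗ N ⟶ (M ⊗ N) ⊗ H :=
  (c ⊗ₘ d) ≫ tensorμ M H N H ≫ (M ⊗ N) ◁ μ[H]

lemma tensorμ_unit_middle (A B D : C) :
    tensorμ A (𝟙_ C) B D =
      (ρ_ A).hom ▷ (B ⊗ D) ≫ (α_ A B D).inv ≫ (A ⊗ B) ◁ (λ_ D).inv := by
  simp only [tensorμ, braiding_tensorUnit_left]
  monoidal

lemma tensorμ_middle_unit (A B D : C) :
    tensorμ A B (𝟙_ C) D =
      (A ⊗ B) ◁ (λ_ D).hom ≫ (α_ A B D).hom ≫ (ρ_ A).inv ▷ (B ⊗ D) := by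
  simp only [tensorμ, braiding_tensorUnit_right]
  monoidal

lemma whiskerRight_tensorHom_tensorμ {A A' B B' : C} (f : A ⟶ A') (g : B ⟶ B') (Y Z : C) :
    (f ▷ Y ⊗ₘ g ▷ Z) ≫ tensorμ A' Y B' Z = tensorμ A Y B Z ≫ (f ⊗ₘ g) ▷ (Y ⊗ Z) := by
  simpa using tensorμ_natural f (𝟙 Y) g (𝟙 Z)

lemma whiskerLeft_tensorHom_tensorμ (Y Z : C) {A A' B B' : C} (f : A ⟶ A') (g : B ⟶ B') :
    (Y ◁ f ⊗ₘ Z ◁ g) ≫ tensorμ Y A' Z B' = tensorμ Y A Z B ≫ (Y ⊗ Z) ◁ (f ⊗ₘ g) := by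
  simpa using tensorμ_natural (𝟙 Y) f (𝟙 Z) g

lemma IsRightAction.tensor {M N H : C} [BimonObj H] {a : M ⊗ H ⟶ M} {b : N ⊗ H ⟶ N}
    (ha : IsRightAction a) (hb : IsRightAction b) : IsRightAction (tensorAction a b) where
  one := by
    have h := tensor_right_unitality M N
    rw [tensorAction, ← whiskerLeft_comp_assoc, BimonObj.one_comul, MonObj.tensorObj.one_def,
      whiskerLeft_comp_assoc, tensorμ_natural_right_assoc, tensorHom_comp_tensorHom, ha.one,
      hb.one, h]
  assoc := by
    simp only [tensorAction, comp_whiskerRight, Category.assoc]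
    rw [← whisker_exchange_assoc, tensorμ_natural_left_assoc, tensorHom_comp_tensorHom, ha.assoc,
      hb.assoc, ← tensorHom_comp_tensorHom, ← whisker_exchange_assoc, tensor_associativity_assoc,
      ← tensorHom_comp_tensorHom, ← tensorμ_natural_right_assoc,
      ← whisker_exchange_assoc, associator_naturality_middle_assoc,
      associator_naturality_right_assoc]
    simp only [← whiskerLeft_comp_assoc]
    rw [← tensorHom_def'_assoc, ← BimonObj.mul_comul]

lemma IsRightCoaction.tensor {M N H : C} [BimonObj H] {c : M ⟶ M ⊗ H} {d : N ⟶ N ⊗ H}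
    (hc : IsRightCoaction c) (hd : IsRightCoaction d) :
    IsRightCoaction (tensorCoaction c d) where
  counit := by
    rw [tensorCoaction, Category.assoc, Category.assoc, ← whiskerLeft_comp, Bimon.mul_counit,
      whiskerLeft_comp, ← reassoc_of% whiskerLeft_tensorHom_tensorμ, tensorHom_comp_tensorHom_assoc,
      hc.counit, hd.counit, ← cancel_mono (ρ_ (M ⊗ N)).hom]
    simp only [Category.assoc, ← rightUnitor_monoidal, tensorHom_comp_tensorHom, Iso.inv_hom_id,
      id_tensorHom_id]
  coassoc := by
    have e : tensorμ (M ⊗ H) H (N ⊗ H) H ≫ tensorμ M H N H ▷ (H ⊗ H) =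
        ((α_ M H H).hom ⊗ₘ (α_ N H H).hom) ≫ tensorμ M (H ⊗ H) N (H ⊗ H) ≫
          (M ⊗ N) ◁ tensorμ H H H H ≫ (α_ (M ⊗ N) (H ⊗ H) (H ⊗ H)).inv := by
      simp only [← cancel_mono (α_ (M ⊗ N) (H ⊗ H) (H ⊗ H)).hom, Category.assoc,
        associator_monoidal, Iso.inv_hom_id, Category.comp_id]
    simp only [tensorCoaction, comp_whiskerRight, Category.assoc]
    rw [whisker_exchange_assoc, ← reassoc_of% whiskerRight_tensorHom_tensorμ,
      tensorHom_comp_tensorHom_assoc, hc.coassoc, hd.coassoc,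
      ← tensorHom_comp_tensorHom_assoc, ← tensorHom_comp_tensorHom_assoc,
      whisker_exchange_assoc, reassoc_of% e, tensorHom_comp_tensorHom_assoc (α_ M H H).inv,
      Iso.inv_hom_id, Iso.inv_hom_id, id_tensorHom_id, Category.id_comp,
      reassoc_of% whiskerLeft_tensorHom_tensorμ, ← whiskerLeft_comp_assoc _ μ[H],
      BimonObj.mul_comul, ← associator_inv_naturality_right_assoc,
      ← associator_inv_naturality_middle, tensorHom_def' μ[H]]
    simp only [whiskerLeft_comp, Category.assoc]

lemma tensorCoaction_comul_whiskerLeft_counit {M H : C} [MonObj H] [ComonObj H]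
    (c : M ⟶ M ⊗ H) :
    tensorCoaction c Δ[H] ≫ (M ◁ ε[H]) ▷ H =
      c ▷ H ≫ (α_ M H H).hom ≫ M ◁ μ[H] ≫ (ρ_ M).inv ▷ H := by
  have e := tensorμ_natural_right M H ε[H] (𝟙 H)
  rw [whiskerLeft_id, tensorHom_id, tensorHom_id] at e
  rw [tensorCoaction, Category.assoc, Category.assoc, whisker_exchange, ← reassoc_of% e,
    MonoidalCategory.tensorHom_def, Category.assoc, ← whiskerLeft_comp_assoc,
    ComonObj.counit_comul, tensorμ_middle_unit, Category.assoc, Category.assoc,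
    whiskerLeft_inv_hom_assoc, ← whisker_exchange]

lemma whiskerLeft_one_tensorAction_mul {M H : C} [MonObj H] [ComonObj H] (a : M ⊗ H ⟶ M) :
    (M ◁ η[H]) ▷ H ≫ tensorAction a μ[H] =
      (ρ_ M).hom ▷ H ≫ M ◁ Δ[H] ≫ (α_ M H H).inv ≫ a ▷ H := by
  have e := tensorμ_natural_left (𝟙 M) η[H] H H
  rw [id_whiskerRight, id_tensorHom, id_tensorHom] at e
  rw [tensorAction, ← whisker_exchange_assoc, reassoc_of% e, tensorHom_def' a,
    ← whiskerLeft_comp_assoc, MonObj.one_mul, tensorμ_unit_middle]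
  simp

variable {M H : C} [HopfObj H]

/-- `M` is a right Hopf module over `H`: the coaction `c` is a morphism of `H`-modules from `M` to
`M ⊗ H` with the diagonal action. -/
structure IsHopfModule (a : M ⊗ H ⟶ M) (c : M ⟶ M ⊗ H) : Prop where
  action : IsRightAction a
  coaction : IsRightCoaction c
  compat : a ≫ c = c ▷ H ≫ tensorAction a μ[H]

/-- The projection `m ↦ m₍₀₎ S(m₍₁₎)` of a Hopf module onto its coinvariants. -/
def coinvProj (a : M ⊗ H ⟶ M) (c : M ⟶ M ⊗ H) : M ⟶ M :=
  c ≫ M ◁ 𝒮[H] ≫ a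

lemma convolve_antipode_convolve_id {N : C} {c : N ⟶ N ⊗ H} {a : M ⊗ H ⟶ M}
    (hc : IsRightCoaction c) (ha : IsRightAction a) (f : N ⟶ M) :
    convolve c a (convolve c a f 𝒮[H]) (𝟙 H) = f := by
  rw [convolve_convolve hc ha, tensorHom_id, HopfObj.antipode_left, convolve_counit_one hc ha]

lemma convolve_id_convolve_antipode {N : C} {c : N ⟶ N ⊗ H} {a : M ⊗ H ⟶ M}
    (hc : IsRightCoaction c) (ha : IsRightAction a) (f : N ⟶ M) :
    convolve c a (convolve c a f (𝟙 H)) 𝒮[H] = f := by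
  rw [convolve_convolve hc ha, id_tensorHom, HopfObj.antipode_right, convolve_counit_one hc ha]

namespace IsHopfModule

variable {a : M ⊗ H ⟶ M} {c : M ⟶ M ⊗ H}

lemma action_comp_coaction (h : IsHopfModule a c) : a ≫ c = tensorCoaction c Δ[H] ≫ a ▷ H := by
  rw [h.compat, tensorAction, tensorCoaction, tensorHom_def' a, tensorHom_def c]
  simp only [Category.assoc]

lemma coaction_coinvProj_action (h : IsHopfModule a c) : c ≫ coinvProj a c ▷ H ≫ a = 𝟙 M := by
  simpa [convolve, coinvProj] using
    convolve_antipode_convolve_id h.coaction h.action (𝟙 M)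

lemma action_coinvProj (h : IsHopfModule a c) :
    a ≫ coinvProj a c = M ◁ ε[H] ≫ (ρ_ M).hom ≫ coinvProj a c := by
  have convolve_id : convolve (tensorCoaction c Δ[H]) a
      (M ◁ ε[H] ≫ (ρ_ M).hom ≫ coinvProj a c) (𝟙 H) = a := by
    simp only [convolve, comp_whiskerRight, Category.assoc, whiskerLeft_id, Category.id_comp]
    rw [reassoc_of% tensorCoaction_comul_whiskerLeft_counit, inv_hom_whiskerRight_assoc,
      whisker_exchange_assoc, ← associator_naturality_left_assoc, ← h.action.assoc,
      ← comp_whiskerRight_assoc, ← comp_whiskerRight_assoc, Category.assoc,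
      h.coaction_coinvProj_action, id_whiskerRight, Category.id_comp]
  conv_rhs => rw [← convolve_id_convolve_antipode
    (h.coaction.tensor (isRightCoaction_comul H)) h.action (M ◁ ε[H] ≫ _), convolve_id]
  rw [coinvProj, reassoc_of% h.action_comp_coaction, convolve]

lemma coinvProj_coaction (h : IsHopfModule a c) :
    coinvProj a c ≫ c = coinvProj a c ≫ (ρ_ M).inv ≫ M ◁ η[H] := by
  have convolve_id : convolve c (tensorAction a μ[H])
      (coinvProj a c ≫ (ρ_ M).inv ≫ M ◁ η[H]) (𝟙 H) = c := by
    simp only [convolve, comp_whiskerRight, Category.assoc, whiskerLeft_id, Category.id_comp]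
    rw [whiskerLeft_one_tensorAction_mul, inv_hom_whiskerRight_assoc, ← whisker_exchange_assoc,
      associator_inv_naturality_left_assoc, ← reassoc_of% h.coaction.coassoc,
      ← comp_whiskerRight, ← comp_whiskerRight, h.coaction_coinvProj_action,
      id_whiskerRight, Category.comp_id]
  conv_rhs => rw [← convolve_id_convolve_antipode
    h.coaction (h.action.tensor (isRightAction_mul H)) (coinvProj a c ≫ _), convolve_id]
  rw [coinvProj, Category.assoc, Category.assoc, h.compat, whisker_exchange_assoc, convolve]

lemma coinvProj_comp_self (h : IsHopfModule a c) :
    coinvProj a c ≫ coinvProj a c = coinvProj a c := by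
  conv_lhs => rhs; rw [coinvProj]
  rw [reassoc_of% h.coinvProj_coaction, ← whiskerLeft_comp_assoc,
    HopfObj.one_antipode, h.action.one, Iso.inv_hom_id, Category.comp_id]

lemma coinvProj_action_coaction_coinvProj (h : IsHopfModule a c) :
    coinvProj a c ▷ H ≫ a ≫ c ≫ coinvProj a c ▷ H = coinvProj a c ▷ H := by
  rw [reassoc_of% h.action_comp_coaction, ← comp_whiskerRight, h.action_coinvProj,
    comp_whiskerRight, comp_whiskerRight, reassoc_of% tensorCoaction_comul_whiskerLeft_counit,
    inv_hom_whiskerRight_assoc, ← comp_whiskerRight_assoc, h.coinvProj_coaction]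
  simp only [comp_whiskerRight, Category.assoc, associator_naturality_middle_assoc]
  rw [← whiskerLeft_comp_assoc, MonObj.one_mul]
  simp [← comp_whiskerRight, h.coinvProj_comp_self]

end IsHopfModule

end HopfModules

section Equivariance

variable {C : Type w} [Category.{v} C] [MonoidalCategory C]

/-- `f` is a morphism of right `H`-modules from `(M, a)` to `(N, b)`. -/
def IsEquivariant {M N H : C} (a : M ⊗ H ⟶ M) (b : N ⊗ H ⟶ N) (f : M ⟶ N) : Prop :=
  a ≫ f = f ▷ H ≫ b

lemma IsEquivariant.comp {M N P H : C} {a : M ⊗ H ⟶ M} {b : N ⊗ H ⟶ N} {c : P ⊗ H ⟶ P}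
    {f : M ⟶ N} {g : N ⟶ P} (hf : IsEquivariant a b f) (hg : IsEquivariant b c g) :
    IsEquivariant a c (f ≫ g) := by
  rw [IsEquivariant, reassoc_of% hf, hg, comp_whiskerRight_assoc]

lemma IsEquivariant.id {M H : C} (a : M ⊗ H ⟶ M) : IsEquivariant a a (𝟙 M) := by
  simp [IsEquivariant]

lemma IsEquivariant.inv {M N H : C} {a : M ⊗ H ⟶ M} {b : N ⊗ H ⟶ N} {f : M ≅ N}
    (hf : IsEquivariant a b f.hom) : IsEquivariant b a f.inv := by
  rw [IsEquivariant, ← cancel_epi (f.hom ▷ H), ← reassoc_of% hf]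
  simp

variable [BraidedCategory C]

lemma IsEquivariant.tensorHom {M M' N N' H : C} [ComonObj H] {a : M ⊗ H ⟶ M} {a' : M' ⊗ H ⟶ M'}
    {b : N ⊗ H ⟶ N} {b' : N' ⊗ H ⟶ N'} {f : M ⟶ M'} {g : N ⟶ N'} (hf : IsEquivariant a a' f)
    (hg : IsEquivariant b b' g) :
    IsEquivariant (tensorAction a b) (tensorAction a' b') (f ⊗ₘ g) := by
  rw [IsEquivariant, tensorAction, Category.assoc, Category.assoc, tensorHom_comp_tensorHom, hf,
    hg, ← tensorHom_comp_tensorHom, tensorAction, ← whisker_exchange_assoc,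
    tensorμ_natural_left_assoc]

lemma tensorAction_tensorAction_left {M N P H : C} [ComonObj H] (a : M ⊗ H ⟶ M)
    (b : N ⊗ H ⟶ N) (c : P ⊗ H ⟶ P) :
    tensorAction (tensorAction a b) c =
      ((M ⊗ N) ⊗ P) ◁ (Δ[H] ≫ Δ[H] ▷ H) ≫ tensorμ (M ⊗ N) P (H ⊗ H) H ≫
        tensorμ M N H H ▷ (P ⊗ H) ≫ ((a ⊗ₘ b) ⊗ₘ c) := by
  have e := tensorμ_natural_right (M ⊗ N) P Δ[H] (𝟙 H)
  rw [whiskerLeft_id, tensorHom_id, tensorHom_id] at e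
  rw [whiskerLeft_comp_assoc, reassoc_of% e, whiskerRight_comp_tensorHom,
    whiskerRight_comp_tensorHom]
  rfl

lemma tensorAction_tensorAction_right {M N P H : C} [ComonObj H] (a : M ⊗ H ⟶ M)
    (b : N ⊗ H ⟶ N) (c : P ⊗ H ⟶ P) :
    tensorAction a (tensorAction b c) =
      (M ⊗ N ⊗ P) ◁ (Δ[H] ≫ H ◁ Δ[H]) ≫ tensorμ M (N ⊗ P) H (H ⊗ H) ≫
        (M ⊗ H) ◁ tensorμ N P H H ≫ (a ⊗ₘ (b ⊗ₘ c)) := by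
  have e := tensorμ_natural_right M (N ⊗ P) (𝟙 H) Δ[H]
  rw [whiskerLeft_id, id_tensorHom, id_tensorHom] at e
  rw [whiskerLeft_comp_assoc, reassoc_of% e, whiskerLeft_comp_tensorHom,
    whiskerLeft_comp_tensorHom]
  rfl

lemma isEquivariant_associator {M N P H : C} [ComonObj H] (a : M ⊗ H ⟶ M) (b : N ⊗ H ⟶ N)
    (c : P ⊗ H ⟶ P) :
    IsEquivariant (tensorAction (tensorAction a b) c) (tensorAction a (tensorAction b c))
      (α_ M N P).hom := by
  rw [IsEquivariant, tensorAction_tensorAction_left, tensorAction_tensorAction_right,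
    ComonObj.comul_assoc_flip]
  simp only [Category.assoc, MonoidalCategory.associator_naturality, associator_monoidal_assoc]
  rw [MonoidalCategory.tensorHom_def (α_ M N P).hom, Category.assoc, whisker_exchange_assoc,
    ← whiskerLeft_comp_assoc]
  simp only [Category.assoc, Iso.inv_hom_id, Category.comp_id]

lemma isEquivariant_rightUnitor_inv {M H : C} [ComonObj H] (a : M ⊗ H ⟶ M) :
    IsEquivariant a (tensorAction a ((λ_ H).hom ≫ ε[H])) (ρ_ M).inv := by
  have counit : M ◁ Δ[H] ≫ (α_ M H H).inv ≫ (M ⊗ H) ◁ ε[H] = (ρ_ (M ⊗ H)).inv := by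
    rw [← associator_inv_naturality_right, ← whiskerLeft_comp_assoc, ComonObj.comul_counit]
    simp
  rw [IsEquivariant, tensorAction, tensorμ_unit_middle, tensorHom_def' a,
    ← whisker_exchange_assoc]
  simp only [Category.assoc, ← whiskerLeft_comp_assoc, Iso.inv_hom_id_assoc,
    inv_hom_whiskerRight_assoc]
  rw [reassoc_of% counit, MonoidalCategory.rightUnitor_inv_naturality]

end Equivariance

section DualPairs

variable {C : Type w} [Category.{v} C] [MonoidalCategory C]

/-- `a` is a left action on `M` of the monoid `H`. -/
structure IsLeftAction {M H : C} [MonObj H] (a : H ⊗ M ⟶ M) : Prop where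
  one : η[H] ▷ M ≫ a = (λ_ M).hom
  mul : μ[H] ▷ M ≫ a = (α_ H H M).hom ≫ H ◁ a ≫ a

/-- A monoid and comonoid `X` and a monoid and comonoid `D` are dual to each other: the evaluation
`D ⊗ X ⟶ 𝟙` pairs the product of each with the coproduct of the other, as in `IsHopfDual` but
without requiring Hopf objects or a braiding. -/
structure IsDualPair (X D : C) [MonObj X] [ComonObj X] [MonObj D] [ComonObj D]
    [ExactPairing X D] : Prop where
  mul_pair : μ[D] ▷ X ≫ ε_ X D = (D ⊗ D) ◁ Δ[X] ≫ nestedEval X D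
  pair_mul : D ◁ μ[X] ≫ ε_ X D = Δ[D] ▷ (X ⊗ X) ≫ nestedEval X D
  one_pair : η[D] ▷ X ≫ ε_ X D = (λ_ X).hom ≫ ε[X]
  pair_one : D ◁ η[X] ≫ ε_ X D = (ρ_ D).hom ≫ ε[D]

lemma eq_of_whiskerLeft_evaluation_whiskerRight {X : C} (D : C) [ExactPairing X D] {T U : C}
    {f g : T ⟶ X ⊗ U} (h : D ◁ f ≫ (α_ D X U).inv ≫ ε_ X D ▷ U =
      D ◁ g ≫ (α_ D X U).inv ≫ ε_ X D ▷ U) : f = g :=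
  (tensorLeftHomEquiv T X D U).symm.injective <| by
    simpa [tensorLeftHomEquiv] using congrArg (· ≫ (λ_ U).hom) h

lemma eq_of_whiskerLeft_evaluation {X : C} (D : C) [ExactPairing X D] {T : C} {f g : T ⟶ X}
    (h : D ◁ f ≫ ε_ X D = D ◁ g ≫ ε_ X D) : f = g := by
  rw [← cancel_mono (ρ_ X).inv]
  apply eq_of_whiskerLeft_evaluation_whiskerRight D
  simp only [MonoidalCategory.rightUnitor_inv_naturality, whiskerLeft_comp, Category.assoc,
    associator_inv_naturality_middle_assoc, ← comp_whiskerRight, h]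

/-- The map `x ↦ x φ ⊗ ε`, where `φ ⊗ ε` is the canonical element of `X ⊗ D`: the coaction of `D`
on `X` that is dual to right multiplication. -/
def coevCoaction (X D : C) [MonObj X] [ExactPairing X D] : X ⟶ X ⊗ D :=
  (ρ_ X).inv ≫ X ◁ η_ X D ≫ (α_ X X D).inv ≫ μ[X] ▷ D

namespace IsDualPair

variable {X D : C} [MonObj X] [ComonObj X] [MonObj D] [ComonObj D] [ExactPairing X D]

lemma whiskerLeft_action_evaluation (h : IsDualPair X D) :
    D ◁ action X D ≫ ε_ X D = (α_ D D X).inv ≫ μ[D] ▷ X ≫ ε_ X D := by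
  rw [h.mul_pair, nestedEval, action]
  monoidal

lemma isLeftAction_action (h : IsDualPair X D) : IsLeftAction (action X D) where
  one := by
    rw [action, ← whisker_exchange_assoc, associator_inv_naturality_left_assoc,
      ← comp_whiskerRight_assoc, h.one_pair]
    simp
  mul := by
    apply eq_of_whiskerLeft_evaluation D
    simp only [whiskerLeft_comp, Category.assoc, h.whiskerLeft_action_evaluation]
    rw [associator_inv_naturality_middle_assoc, ← comp_whiskerRight_assoc,
      associator_inv_naturality_right_assoc, whisker_exchange_assoc,
      h.whiskerLeft_action_evaluation, associator_inv_naturality_left_assoc,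
      ← comp_whiskerRight_assoc, MonObj.mul_assoc_flip]
    simp

lemma coev_action (h : IsDualPair X D) :
    (ρ_ D).inv ≫ D ◁ η_ X D ≫ (α_ D X D).inv ≫ action X D ▷ D =
      (λ_ D).inv ≫ η_ X D ▷ D ≫ (α_ X D D).hom ≫ X ◁ μ[D] := by
  apply eq_of_whiskerLeft_evaluation_whiskerRight D
  calc
    _ = 𝟙 _ ⊗≫ D ◁ D ◁ η_ X D ⊗≫ (D ◁ action X D ≫ ε_ X D) ▷ D := by monoidal
    _ = 𝟙 _ ⊗≫ ((D ⊗ D) ◁ η_ X D ≫ μ[D] ▷ (X ⊗ D)) ⊗≫ ε_ X D ▷ D := by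
      rw [h.whiskerLeft_action_evaluation]; monoidal
    _ = 𝟙 _ ⊗≫ μ[D] ⊗≫ (D ◁ η_ X D ⊗≫ ε_ X D ▷ D) := by
      rw [whisker_exchange]; monoidal
    _ = 𝟙 _ ⊗≫ (D ◁ η_ X D ⊗≫ ε_ X D ▷ D) ▷ D ⊗≫ μ[D] ⊗≫ 𝟙 _ := by
      rw [ExactPairing.coevaluation_evaluation'']; monoidal
    _ = 𝟙 _ ⊗≫ D ◁ η_ X D ▷ D ⊗≫ (ε_ X D ▷ (D ⊗ D) ≫ 𝟙_ C ◁ μ[D]) ⊗≫ 𝟙 _ := by monoidal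
    _ = _ := by rw [← whisker_exchange]; monoidal

lemma coev_counit (h : IsDualPair X D) : η_ X D ≫ X ◁ ε[D] = η[X] ≫ (ρ_ X).inv := by
  apply eq_of_whiskerLeft_evaluation_whiskerRight D
  calc
    _ = 𝟙 _ ⊗≫ D ◁ η_ X D ⊗≫ (ε_ X D ▷ D ≫ 𝟙_ C ◁ ε[D]) := by
      rw [← whisker_exchange]; monoidal
    _ = 𝟙 _ ⊗≫ (D ◁ η_ X D ⊗≫ ε_ X D ▷ D) ⊗≫ ε[D] ⊗≫ 𝟙 _ := by monoidal
    _ = 𝟙 _ ⊗≫ ε[D] ⊗≫ 𝟙 _ := by rw [ExactPairing.coevaluation_evaluation'']; monoidal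
    _ = 𝟙 _ ⊗≫ (D ◁ η[X] ≫ ε_ X D) ⊗≫ 𝟙 _ := by rw [h.pair_one]; monoidal
    _ = _ := by monoidal

lemma coev_comul (h : IsDualPair X D) :
    η_ X D ≫ X ◁ Δ[D] = η_ X D ⊗≫ X ◁ η_ X D ▷ D ⊗≫ μ[X] ▷ (D ⊗ D) := by
  apply eq_of_whiskerLeft_evaluation_whiskerRight D
  calc
    _ = 𝟙 _ ⊗≫ D ◁ η_ X D ⊗≫ (ε_ X D ▷ D ≫ 𝟙_ C ◁ Δ[D]) := by
      rw [← whisker_exchange]; monoidal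
    _ = 𝟙 _ ⊗≫ (D ◁ η_ X D ⊗≫ ε_ X D ▷ D) ⊗≫ Δ[D] ⊗≫ 𝟙 _ := by monoidal
    _ = 𝟙 _ ⊗≫ Δ[D] ⊗≫ 𝟙 _ := by rw [ExactPairing.coevaluation_evaluation'']; monoidal
    _ = 𝟙 _ ⊗≫ Δ[D] ⊗≫ D ◁ (D ◁ η_ X D ⊗≫ ε_ X D ▷ D) ⊗≫
        (D ◁ η_ X D ⊗≫ ε_ X D ▷ D) ▷ D ⊗≫ 𝟙 _ := by
      rw [ExactPairing.coevaluation_evaluation'']; monoidal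
    _ = 𝟙 _ ⊗≫ Δ[D] ⊗≫ D ◁ D ◁ η_ X D ⊗≫ D ◁ (ε_ X D ▷ D ≫ 𝟙_ C ◁ ((λ_ D).inv ≫ η_ X D ▷ D)) ⊗≫
        ε_ X D ▷ D ▷ D ⊗≫ 𝟙 _ := by monoidal
    _ = 𝟙 _ ⊗≫ (Δ[D] ▷ 𝟙_ C ≫ (D ⊗ D) ◁ η_ X D) ⊗≫ D ◁ D ◁ X ◁ η_ X D ▷ D ⊗≫
        D ◁ ε_ X D ▷ X ▷ D ▷ D ⊗≫ ε_ X D ▷ D ▷ D ⊗≫ 𝟙 _ := by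
      rw [← whisker_exchange]; monoidal
    _ = 𝟙 _ ⊗≫ D ◁ η_ X D ⊗≫ (Δ[D] ▷ (X ⊗ 𝟙_ C ⊗ D) ≫ (D ⊗ D) ◁ X ◁ η_ X D ▷ D) ⊗≫
        D ◁ ε_ X D ▷ X ▷ D ▷ D ⊗≫ ε_ X D ▷ D ▷ D ⊗≫ 𝟙 _ := by
      rw [← whisker_exchange]; monoidal
    _ = 𝟙 _ ⊗≫ D ◁ η_ X D ⊗≫ D ◁ X ◁ η_ X D ▷ D ⊗≫ (D ◁ μ[X] ≫ ε_ X D) ▷ (D ⊗ D) := by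
      rw [h.pair_mul, nestedEval, ← whisker_exchange]; monoidal
    _ = _ := by monoidal

lemma isRightCoaction_coevCoaction (h : IsDualPair X D) : IsRightCoaction (coevCoaction X D) where
  counit := by
    rw [coevCoaction]
    simp only [Category.assoc]
    rw [← whisker_exchange, ← associator_inv_naturality_right_assoc, ← whiskerLeft_comp_assoc,
      h.coev_counit]
    simp
  coassoc := by
    calc
      _ = 𝟙 _ ⊗≫ X ◁ η_ X D ⊗≫ μ[X] ▷ D ⊗≫ X ◁ η_ X D ▷ D ⊗≫ μ[X] ▷ D ▷ D := by
        rw [coevCoaction]; monoidal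
      _ = 𝟙 _ ⊗≫ X ◁ η_ X D ⊗≫ (μ[X] ▷ (𝟙_ C ⊗ D) ≫ X ◁ η_ X D ▷ D) ⊗≫ μ[X] ▷ D ▷ D := by
        monoidal
      _ = 𝟙 _ ⊗≫ X ◁ η_ X D ⊗≫ X ◁ X ◁ η_ X D ▷ D ⊗≫ (μ[X] ▷ X ≫ μ[X]) ▷ (D ⊗ D) ⊗≫ 𝟙 _ := by
        rw [← whisker_exchange]; monoidal
      _ = 𝟙 _ ⊗≫ X ◁ (η_ X D ⊗≫ X ◁ η_ X D ▷ D ⊗≫ μ[X] ▷ (D ⊗ D)) ⊗≫ μ[X] ▷ (D ⊗ D) ⊗≫ 𝟙 _ := by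
        rw [MonObj.mul_assoc]; monoidal
      _ = 𝟙 _ ⊗≫ X ◁ η_ X D ⊗≫ ((X ⊗ X) ◁ Δ[D] ≫ μ[X] ▷ (D ⊗ D)) ⊗≫ 𝟙 _ := by
        rw [← h.coev_comul]; monoidal
      _ = _ := by rw [whisker_exchange, coevCoaction]; monoidal

end IsDualPair

end DualPairs

section Braided

variable {C : Type w} [Category.{v} C] [MonoidalCategory C] [BraidedCategory C]

/-- The right action `m h = S(h) m` obtained from a left action of a Hopf object. -/
def antipodeAction {M H : C} [HopfObj H] (a : H ⊗ M ⟶ M) : M ⊗ H ⟶ M :=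
  (β_ M H).hom ≫ 𝒮[H] ▷ M ≫ a

lemma IsLeftAction.antipodeAction {M H : C} [HopfObj H] {a : H ⊗ M ⟶ M} (ha : IsLeftAction a) :
    IsRightAction (antipodeAction a) where
  one := by
    rw [BraidedIntegral.antipodeAction, BraidedCategory.braiding_naturality_right_assoc,
      ← comp_whiskerRight_assoc, HopfObj.one_antipode, ha.one, braiding_leftUnitor]
  assoc := by
    rw [BraidedIntegral.antipodeAction]
    calc
      _ = ((β_ M H).hom ≫ 𝒮[H] ▷ M ≫ a) ▷ H ≫ (β_ M H).hom ≫ 𝒮[H] ▷ M ≫ a := rfl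
      _ = (β_ (M ⊗ H) H).hom ≫ H ◁ (β_ M H).hom ≫ H ◁ 𝒮[H] ▷ M ≫ (H ◁ a ≫ 𝒮[H] ▷ M) ≫ a := by
        rw [BraidedCategory.braiding_naturality_left_assoc]; simp
      _ = (β_ (M ⊗ H) H).hom ≫ H ◁ (β_ M H).hom ≫ (α_ H H M).inv ≫ (𝒮[H] ⊗ₘ 𝒮[H]) ▷ M ≫
          (α_ H H M).hom ≫ H ◁ a ≫ a := by
        rw [whisker_exchange, MonoidalCategory.tensorHom_def']; simp
      _ = (α_ M H H).hom ≫ (M ◁ (β_ H H).hom ≫ (β_ M (H ⊗ H)).hom) ≫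
          ((𝒮[H] ⊗ₘ 𝒮[H]) ≫ μ[H]) ▷ M ≫ a := by
        rw [← ha.mul]; simp
      _ = (α_ M H H).hom ≫ (β_ M (H ⊗ H)).hom ≫ (μ[H] ≫ 𝒮[H]) ▷ M ≫ a := by
        rw [BraidedCategory.braiding_naturality_right, HopfObj.mul_antipode,
          BraidedCategory.braiding_naturality_assoc]
        simp only [comp_whiskerRight, Category.assoc]
      _ = _ := by
        rw [comp_whiskerRight_assoc, BraidedCategory.braiding_naturality_right_assoc]

lemma braiding_whiskerRight_evaluation (X D A : C) [ExactPairing X D] :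
    (β_ D A).hom ▷ X ≫ (α_ A D X).hom ≫ A ◁ ε_ X D ≫ (ρ_ A).hom =
      (α_ D A X).hom ≫ D ◁ (β_ X A).inv ≫ (α_ D X A).inv ≫ ε_ X D ▷ A ≫ (λ_ A).hom := by
  calc
    _ = (α_ D A X).hom ≫ D ◁ ((β_ X A).inv ≫ (β_ X A).hom) ≫ (α_ D A X).inv ≫
        (β_ D A).hom ▷ X ≫ (α_ A D X).hom ≫ A ◁ ε_ X D ≫ (ρ_ A).hom := by simp
    _ = (α_ D A X).hom ≫ D ◁ (β_ X A).inv ≫ (α_ D X A).inv ≫ (β_ (D ⊗ X) A).hom ≫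
        A ◁ ε_ X D ≫ (ρ_ A).hom := by simp
    _ = _ := by rw [← BraidedCategory.braiding_naturality_left_assoc, braiding_rightUnitor]

lemma IsDualPair.whiskerLeft_mul_action {X D : C} [MonObj X] [ComonObj X] [BimonObj D]
    [ExactPairing X D] (h : IsDualPair X D) :
    D ◁ μ[X] ≫ action X D =
      Δ[D] ▷ (X ⊗ X) ⊗≫ D ◁ action X D ▷ X ⊗≫ (β_ X D).inv ▷ X ⊗≫ X ◁ action X D ≫ μ[X] := by
  have ev_mul : μ[D] ▷ X ≫ ε_ X D = (α_ D D X).hom ≫ D ◁ action X D ≫ ε_ X D := by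
    rw [h.whiskerLeft_action_evaluation, Iso.hom_inv_id_assoc]
  apply eq_of_whiskerLeft_evaluation D
  calc
    _ = 𝟙 _ ⊗≫ (D ⊗ D) ◁ μ[X] ⊗≫ (D ◁ action X D ≫ ε_ X D) := by
      monoidal
    _ = 𝟙 _ ⊗≫ ((D ⊗ D) ◁ μ[X] ≫ μ[D] ▷ X) ≫ ε_ X D := by
      rw [h.whiskerLeft_action_evaluation]; monoidal
    _ = 𝟙 _ ⊗≫ (μ[D] ≫ Δ[D]) ▷ (X ⊗ X) ≫ nestedEval X D := by
      rw [whisker_exchange, Category.assoc, h.pair_mul]; monoidal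
    _ = 𝟙 _ ⊗≫ (Δ[D] ⊗ₘ Δ[D]) ▷ (X ⊗ X) ⊗≫ D ◁ (β_ D D).hom ▷ (D ⊗ X ⊗ X) ⊗≫
        (D ⊗ D) ◁ (μ[D] ▷ X) ▷ X ⊗≫ (μ[D] ▷ ((D ⊗ X) ⊗ X) ≫ D ◁ ε_ X D ▷ X) ⊗≫ ε_ X D := by
      rw [BimonObj.mul_comul, tensorμ, nestedEval, tensorHom_def' μ[D]]; monoidal
    _ = 𝟙 _ ⊗≫ (Δ[D] ⊗ₘ Δ[D]) ▷ (X ⊗ X) ⊗≫ D ◁ (β_ D D).hom ▷ (D ⊗ X ⊗ X) ⊗≫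
        (D ⊗ D) ◁ (μ[D] ▷ X ≫ ε_ X D) ▷ X ⊗≫ μ[D] ▷ X ≫ ε_ X D := by
      rw [← whisker_exchange]; monoidal
    _ = 𝟙 _ ⊗≫ Δ[D] ▷ (D ⊗ X ⊗ X) ⊗≫ D ◁ D ◁ Δ[D] ▷ (X ⊗ X) ⊗≫
        D ◁ ((β_ D D).hom ▷ (D ⊗ X) ≫ (D ⊗ D) ◁ action X D) ▷ X ⊗≫
        D ◁ D ◁ ε_ X D ▷ X ⊗≫ D ◁ action X D ≫ ε_ X D := by
      rw [ev_mul, MonoidalCategory.tensorHom_def Δ[D]]; monoidal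
    _ = 𝟙 _ ⊗≫ Δ[D] ▷ (D ⊗ X ⊗ X) ⊗≫ D ◁ D ◁ Δ[D] ▷ (X ⊗ X) ⊗≫
        D ◁ D ◁ D ◁ action X D ▷ X ⊗≫
        D ◁ ((β_ D D).hom ▷ X ≫ (α_ D D X).hom ≫ D ◁ ε_ X D ≫ (ρ_ D).hom) ▷ X ⊗≫
        D ◁ action X D ≫ ε_ X D := by
      rw [← whisker_exchange]; monoidal
    _ = 𝟙 _ ⊗≫ Δ[D] ▷ (D ⊗ X ⊗ X) ⊗≫ D ◁ D ◁ Δ[D] ▷ (X ⊗ X) ⊗≫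
        D ◁ D ◁ D ◁ action X D ▷ X ⊗≫ D ◁ D ◁ (β_ X D).inv ▷ X ⊗≫
        D ◁ (ε_ X D ▷ (D ⊗ X) ≫ 𝟙_ C ◁ action X D) ⊗≫ ε_ X D := by
      rw [braiding_whiskerRight_evaluation]; monoidal
    _ = 𝟙 _ ⊗≫ (Δ[D] ▷ (D ⊗ X ⊗ X) ≫ (D ⊗ D) ◁ (Δ[D] ▷ (X ⊗ X) ⊗≫
        D ◁ action X D ▷ X ⊗≫ (β_ X D).inv ▷ X ⊗≫ X ◁ action X D)) ≫ nestedEval X D := by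
      rw [← whisker_exchange, nestedEval]; monoidal
    _ = _ := by rw [← whisker_exchange, Category.assoc, ← h.pair_mul]; monoidal

lemma tensorμ_tensorHom_braiding {A A' B B' P Q : C} (f : P ⊗ A ⟶ A') (g : Q ⊗ B ⟶ B') :
    tensorμ A B P Q ≫ ((β_ A P).hom ≫ f ⊗ₘ (β_ B Q).hom ≫ g) =
      (β_ (A ⊗ B) (P ⊗ Q)).hom ≫ (β_ P Q).hom ▷ (A ⊗ B) ⊗≫ Q ◁ f ▷ B ⊗≫
        (β_ A' Q).inv ▷ B ⊗≫ A' ◁ g := by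
  symm
  calc
    _ = 𝟙 _ ⊗≫ A ◁ (β_ B P).hom ▷ Q ⊗≫ ((β_ A P).hom ▷ (B ⊗ Q) ≫ (P ⊗ A) ◁ (β_ B Q).hom) ⊗≫
        ((β_ (P ⊗ A) Q).hom ≫ Q ◁ f) ▷ B ⊗≫ (β_ A' Q).inv ▷ B ⊗≫ A' ◁ g := by
      simp only [BraidedCategory.braiding_tensor_left_hom,
        BraidedCategory.braiding_tensor_right_hom]
      monoidal
    _ = 𝟙 _ ⊗≫ A ◁ (β_ B P).hom ▷ Q ⊗≫ ((β_ A P).hom ▷ (B ⊗ Q) ≫ (P ⊗ A) ◁ (β_ B Q).hom) ⊗≫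
        (f ▷ Q ≫ (β_ A' Q).hom ≫ (β_ A' Q).inv) ▷ B ⊗≫ A' ◁ g := by
      rw [← BraidedCategory.braiding_naturality_left]; monoidal
    _ = 𝟙 _ ⊗≫ A ◁ (β_ B P).hom ▷ Q ⊗≫ ((β_ A P).hom ▷ (B ⊗ Q) ≫ (P ⊗ A) ◁ (β_ B Q).hom) ⊗≫
        (f ▷ (Q ⊗ B) ≫ A' ◁ g) := by
      rw [Iso.hom_inv_id]; monoidal
    _ = 𝟙 _ ⊗≫ A ◁ (β_ B P).hom ▷ Q ⊗≫ ((β_ A P).hom ≫ f ⊗ₘ (β_ B Q).hom ≫ g) := by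
      rw [MonoidalCategory.tensorHom_def, whiskerLeft_comp, comp_whiskerRight, Category.assoc,
        ← whisker_exchange_assoc]
      monoidal
    _ = _ := by rw [tensorμ]; monoidal

lemma isEquivariant_mul {X D : C} [MonObj X] [ComonObj X] [HopfObj D]
    [ExactPairing X D] (h : IsDualPair X D) :
    IsEquivariant (tensorAction (antipodeAction (action X D)) (antipodeAction (action X D)))
      (antipodeAction (action X D)) μ[X] := by
  rw [IsEquivariant, antipodeAction, tensorAction, Category.assoc, Category.assoc,
    BraidedCategory.braiding_naturality_left_assoc, whisker_exchange_assoc,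
    h.whiskerLeft_mul_action, reassoc_of% tensorμ_tensorHom_braiding]
  symm
  calc
    _ = (β_ (X ⊗ X) D).hom ≫ (𝒮[D] ≫ Δ[D]) ▷ (X ⊗ X) ⊗≫ D ◁ action X D ▷ X ⊗≫
        (β_ X D).inv ▷ X ⊗≫ X ◁ action X D ≫ μ[X] := by
      monoidal
    _ = ((β_ (X ⊗ X) D).hom ≫ Δ[D] ▷ (X ⊗ X)) ≫ (β_ D D).hom ▷ (X ⊗ X) ⊗≫
        (𝒮[D] ⊗ₘ 𝒮[D]) ▷ (X ⊗ X) ⊗≫ D ◁ action X D ▷ X ⊗≫ (β_ X D).inv ▷ X ⊗≫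
        X ◁ action X D ≫ μ[X] := by
      rw [HopfObj.antipode_comul]; monoidal
    _ = (X ⊗ X) ◁ Δ[D] ≫ (β_ (X ⊗ X) (D ⊗ D)).hom ≫ (β_ D D).hom ▷ (X ⊗ X) ⊗≫
        D ◁ 𝒮[D] ▷ (X ⊗ X) ⊗≫ (𝒮[D] ▷ (D ⊗ X) ≫ D ◁ action X D) ▷ X ⊗≫
        (β_ X D).inv ▷ X ⊗≫ X ◁ action X D ≫ μ[X] := by
      rw [← BraidedCategory.braiding_naturality_right, tensorHom_def']; monoidal
    _ = (X ⊗ X) ◁ Δ[D] ≫ (β_ (X ⊗ X) (D ⊗ D)).hom ≫ (β_ D D).hom ▷ (X ⊗ X) ⊗≫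
        D ◁ (𝒮[D] ▷ X ≫ action X D) ▷ X ⊗≫ (𝒮[D] ▷ X ≫ (β_ X D).inv) ▷ X ⊗≫
        X ◁ action X D ≫ μ[X] := by
      rw [← whisker_exchange]; monoidal
    _ = _ := by rw [BraidedCategory.braiding_inv_naturality_left]; monoidal

lemma isEquivariant_coev {X D : C} [MonObj X] [ComonObj X] [HopfObj D]
    [ExactPairing X D] (h : IsDualPair X D) :
    IsEquivariant ((λ_ D).hom ≫ ε[D]) (tensorAction (antipodeAction (action X D)) μ[D])
      (η_ X D) := by
  rw [IsEquivariant]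
  symm
  calc
    _ = (η_ X D ▷ D ≫ (X ⊗ D) ◁ Δ[D]) ≫ tensorμ X D D D ≫
        (antipodeAction (action X D) ▷ (D ⊗ D) ≫ X ◁ μ[D]) := by
      rw [tensorAction, MonoidalCategory.tensorHom_def, Category.assoc]
    _ = 𝟙 _ ⊗≫ Δ[D] ⊗≫ (η_ X D ▷ D ≫ (β_ (X ⊗ D) D).hom) ▷ D ⊗≫
        (𝒮[D] ▷ X ≫ action X D) ▷ (D ⊗ D) ⊗≫ X ◁ μ[D] := by
      rw [← whisker_exchange, tensorμ, antipodeAction,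
        BraidedCategory.braiding_tensor_left_hom]
      monoidal
    _ = 𝟙 _ ⊗≫ Δ[D] ⊗≫ (D ◁ η_ X D ≫ 𝒮[D] ▷ (X ⊗ D)) ▷ D ⊗≫
        action X D ▷ (D ⊗ D) ⊗≫ X ◁ μ[D] := by
      rw [BraidedCategory.braiding_naturality_left, braiding_tensorUnit_left]
      monoidal
    _ = 𝟙 _ ⊗≫ Δ[D] ⊗≫ 𝒮[D] ▷ D ⊗≫
        ((ρ_ D).inv ≫ D ◁ η_ X D ≫ (α_ D X D).inv ≫ action X D ▷ D) ▷ D ⊗≫ X ◁ μ[D] := by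
      rw [whisker_exchange]; monoidal
    _ = 𝟙 _ ⊗≫ Δ[D] ⊗≫ 𝒮[D] ▷ D ⊗≫ η_ X D ▷ (D ⊗ D) ⊗≫ X ◁ (μ[D] ▷ D ≫ μ[D]) := by
      rw [h.coev_action]; monoidal
    _ = 𝟙 _ ⊗≫ (Δ[D] ≫ 𝒮[D] ▷ D) ⊗≫ (η_ X D ▷ (D ⊗ D) ≫ (X ⊗ D) ◁ μ[D]) ⊗≫ X ◁ μ[D] := by
      rw [MonObj.mul_assoc]; monoidal
    _ = 𝟙 _ ⊗≫ (Δ[D] ≫ 𝒮[D] ▷ D ≫ μ[D]) ⊗≫ η_ X D ▷ D ⊗≫ X ◁ μ[D] := by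
      rw [← whisker_exchange]; monoidal
    _ = 𝟙 _ ⊗≫ ε[D] ⊗≫ (𝟙_ C ◁ η[D] ≫ η_ X D ▷ D) ⊗≫ X ◁ μ[D] := by
      rw [HopfObj.antipode_left]; monoidal
    _ = 𝟙 _ ⊗≫ ε[D] ⊗≫ η_ X D ⊗≫ X ◁ (D ◁ η[D] ≫ μ[D]) := by
      rw [whisker_exchange]; monoidal
    _ = _ := by rw [MonObj.mul_one]; monoidal

lemma isEquivariant_coevCoaction {X D : C} [MonObj X] [ComonObj X] [HopfObj D]
    [ExactPairing X D] (h : IsDualPair X D) :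
    IsEquivariant (antipodeAction (action X D))
      (tensorAction (antipodeAction (action X D)) μ[D]) (coevCoaction X D) := by
  have unit := isEquivariant_rightUnitor_inv (antipodeAction (action X D))
  have coev := IsEquivariant.tensorHom
    (IsEquivariant.id (antipodeAction (action X D))) (isEquivariant_coev h)
  have assoc := (isEquivariant_associator (antipodeAction (action X D))
    (antipodeAction (action X D)) μ[D]).inv
  have mul := IsEquivariant.tensorHom (isEquivariant_mul h) (IsEquivariant.id μ[D])
  simpa [coevCoaction] using unit.comp (coev.comp (assoc.comp mul))

lemma isHopfModule_coevCoaction {X D : C} [MonObj X] [ComonObj X] [HopfObj D]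
    [ExactPairing X D] (h : IsDualPair X D) :
    IsHopfModule (antipodeAction (action X D)) (coevCoaction X D) where
  action := h.isLeftAction_action.antipodeAction
  coaction := h.isRightCoaction_coevCoaction
  compat := isEquivariant_coevCoaction h

end Braided

section Reversal

variable {C : Type w} [Category.{v} C] [MonoidalCategory C] [BraidedCategory C]

/-- The opposite of a monoid, with respect to the inverse braiding. -/
abbrev opMonObj (X : C) [MonObj X] : MonObj X where
  one := η[X]
  mul := (β_ X X).inv ≫ μ[X]
  one_mul := by simp
  mul_one := by simp
  mul_assoc := by
    calc
      _ = (β_ X X).inv ▷ X ≫ (β_ X (X ⊗ X)).inv ≫ X ◁ μ[X] ≫ μ[X] := by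
        rw [comp_whiskerRight_assoc, BraidedCategory.braiding_inv_naturality_left_assoc]
      _ = (α_ X X X).hom ≫ X ◁ (β_ X X).inv ≫ (β_ (X ⊗ X) X).inv ≫ μ[X] ▷ X ≫ μ[X] := by
        rw [BraidedCategory.braiding_inv_naturality_left_assoc, MonObj.mul_assoc]
        simp only [BraidedCategory.braiding_tensor_left_inv,
          BraidedCategory.braiding_tensor_right_inv, Category.assoc, Iso.inv_hom_id_assoc]
      _ = _ := by
        rw [whiskerLeft_comp_assoc,
          BraidedCategory.braiding_inv_naturality_right_assoc X (Z := X) μ[X]]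

/-- The co-opposite of a comonoid, with respect to the inverse braiding. -/
abbrev copComonObj (D : C) [ComonObj D] : ComonObj D where
  counit := ε[D]
  comul := Δ[D] ≫ (β_ D D).inv
  counit_comul := by simp [← BraidedCategory.braiding_inv_naturality_right]
  comul_counit := by simp [← BraidedCategory.braiding_inv_naturality_left]
  comul_assoc := by
    calc
      _ = Δ[D] ≫ Δ[D] ▷ D ≫ (β_ D (D ⊗ D)).inv ≫ D ◁ (β_ D D).inv := by
        rw [whiskerLeft_comp, Category.assoc, BraidedCategory.braiding_inv_naturality_left_assoc]
      _ = Δ[D] ≫ D ◁ Δ[D] ≫ (β_ (D ⊗ D) D).inv ≫ (β_ D D).inv ▷ D ≫ (α_ D D D).hom := by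
        rw [ComonObj.comul_assoc_assoc, ← BraidedCategory.braiding_inv_naturality_right_assoc]
        simp only [BraidedCategory.braiding_tensor_left_inv,
          BraidedCategory.braiding_tensor_right_inv, Category.assoc, Iso.inv_hom_id,
          Category.comp_id]
      _ = _ := by
        rw [comp_whiskerRight, Category.assoc, Category.assoc,
          BraidedCategory.braiding_inv_naturality_right_assoc]

lemma tensorμ_braiding_inv (A B P Q : C) :
    tensorμ A B P Q ≫ (β_ (B ⊗ Q) (A ⊗ P)).inv =
      ((β_ B A).inv ⊗ₘ (β_ Q P).inv) ≫ @tensorμ C _ _ (reverseBraiding C) B A Q P := by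
  calc
    _ = 𝟙 _ ⊗≫ A ◁ ((β_ B P).hom ≫ (β_ B P).inv) ▷ Q ⊗≫
        ((β_ B A).inv ▷ (P ⊗ Q) ≫ (B ⊗ A) ◁ (β_ Q P).inv) ⊗≫ B ◁ (β_ Q A).inv ▷ P ⊗≫ 𝟙 _ := by
      simp only [tensorμ, BraidedCategory.braiding_tensor_left_inv,
        BraidedCategory.braiding_tensor_right_inv]
      rw [← whisker_exchange]
      monoidal
    _ = _ := by
      rw [Iso.hom_inv_id, MonoidalCategory.tensorHom_def]
      dsimp only [tensorμ, reverseBraiding, Iso.symm_hom]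
      monoidal

/-- The co-opposite of a bimonoid, a bimonoid for the inverse braiding. -/
abbrev copBimonObj (D : C) [BimonObj D] : @BimonObj C _ _ (reverseBraiding C) D :=
  @BimonObj.mk C _ _ (reverseBraiding C) D _ (copComonObj D)
    (by
      change μ[D] ≫ Δ[D] ≫ (β_ D D).inv = ((Δ[D] ≫ (β_ D D).inv) ⊗ₘ (Δ[D] ≫ (β_ D D).inv)) ≫ _
      rw [BimonObj.mul_comul_assoc, BraidedCategory.braiding_inv_naturality,
        reassoc_of% tensorμ_braiding_inv, ← tensorHom_comp_tensorHom_assoc])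
    (by
      change η[D] ≫ Δ[D] ≫ (β_ D D).inv = (λ_ (𝟙_ C)).inv ≫ (η[D] ⊗ₘ η[D])
      rw [BimonObj.one_comul_assoc, MonObj.tensorObj.one_def, Category.assoc,
        BraidedCategory.braiding_inv_naturality]
      simp [← unitors_inv_equal])
    (BimonObj.mul_counit D)
    (BimonObj.one_counit D)

/-- The co-opposite of a Hopf object with invertible antipode: a Hopf object for the
inverse braiding, with antipode `𝒮⁻¹`. -/
noncomputable abbrev copHopfObj (D : C) [HopfObj D] [IsIso 𝒮[D]] :
    @HopfObj C _ _ (reverseBraiding C) D :=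
  @HopfObj.mk C _ _ (reverseBraiding C) D (copBimonObj D) (inv 𝒮[D])
    (by
      change (Δ[D] ≫ (β_ D D).inv) ≫ inv 𝒮[D] ▷ D ≫ μ[D] = ε[D] ≫ η[D]
      rw [← cancel_mono 𝒮[D]]
      simp only [Category.assoc, HopfObj.mul_antipode, HopfObj.one_antipode]
      rw [whiskerRight_comp_tensorHom_assoc, IsIso.inv_hom_id, id_tensorHom,
        BraidedCategory.braiding_naturality_right_assoc, Iso.inv_hom_id_assoc,
        HopfObj.antipode_left])
    (by
      change (Δ[D] ≫ (β_ D D).inv) ≫ D ◁ inv 𝒮[D] ≫ μ[D] = ε[D] ≫ η[D]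
      rw [← cancel_mono 𝒮[D]]
      simp only [Category.assoc, HopfObj.mul_antipode, HopfObj.one_antipode]
      rw [whiskerLeft_comp_tensorHom_assoc, IsIso.inv_hom_id, tensorHom_id,
        BraidedCategory.braiding_naturality_left_assoc, Iso.inv_hom_id_assoc,
        HopfObj.antipode_right])

lemma whiskerLeft_braiding_evaluation (X D A : C) [ExactPairing X D] :
    D ◁ (β_ A X).hom ≫ (α_ D X A).inv ≫ ε_ X D ▷ A ≫ (λ_ A).hom =
      (α_ D A X).inv ≫ (β_ A D).inv ▷ X ≫ (α_ A D X).hom ≫ A ◁ ε_ X D ≫ (ρ_ A).hom := by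
  calc
    _ = (α_ D A X).inv ≫ ((β_ A D).inv ≫ (β_ A D).hom) ▷ X ≫ (α_ D A X).hom ≫
        D ◁ (β_ A X).hom ≫ (α_ D X A).inv ≫ ε_ X D ▷ A ≫ (λ_ A).hom := by simp
    _ = (α_ D A X).inv ≫ (β_ A D).inv ▷ X ≫ (α_ A D X).hom ≫ (β_ A (D ⊗ X)).hom ≫
        ε_ X D ▷ A ≫ (λ_ A).hom := by simp
    _ = _ := by rw [← BraidedCategory.braiding_naturality_right_assoc, braiding_leftUnitor]

lemma braiding_nestedEval (X D : C) [ExactPairing X D] :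
    (β_ D D).hom ▷ (X ⊗ X) ≫ nestedEval X D = (D ⊗ D) ◁ (β_ X X).hom ≫ nestedEval X D := by
  calc
    _ = 𝟙 _ ⊗≫ ((β_ D D).hom ▷ X ≫ (α_ D D X).hom ≫ D ◁ ε_ X D ≫ (ρ_ D).hom) ▷ X ⊗≫ ε_ X D := by
      rw [nestedEval]; monoidal
    _ = 𝟙 _ ⊗≫ D ◁ (β_ X D).inv ▷ X ⊗≫ (ε_ X D ▷ (D ⊗ X) ≫ 𝟙_ C ◁ ε_ X D) ⊗≫ 𝟙 _ := by
      rw [braiding_whiskerRight_evaluation]; monoidal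
    _ = 𝟙 _ ⊗≫ D ◁ ((α_ D X X).inv ≫ (β_ X D).inv ▷ X ≫ (α_ X D X).hom ≫ X ◁ ε_ X D ≫
        (ρ_ X).hom) ⊗≫ ε_ X D := by
      rw [← whisker_exchange]; monoidal
    _ = _ := by rw [← whiskerLeft_braiding_evaluation, nestedEval]; monoidal

lemma braiding_inv_nestedEval (X D : C) [ExactPairing X D] :
    (β_ D D).inv ▷ (X ⊗ X) ≫ nestedEval X D = (D ⊗ D) ◁ (β_ X X).inv ≫ nestedEval X D := by
  rw [← cancel_epi ((β_ D D).hom ▷ (X ⊗ X)), hom_inv_whiskerRight_assoc, ← whisker_exchange_assoc,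
    braiding_nestedEval, whiskerLeft_inv_hom_assoc]

variable {X D : C} [HopfObj X] [HopfObj D] [ExactPairing X D]

lemma IsHopfDual.isDualPair_op (h : IsHopfDual X D) :
    @IsDualPair C _ _ X D (opMonObj X) _ _ (copComonObj D) _ :=
  @IsDualPair.mk C _ _ X D (opMonObj X) _ _ (copComonObj D) _ h.mul_pair
    (by
      change D ◁ ((β_ X X).inv ≫ μ[X]) ≫ ε_ X D =
        (Δ[D] ≫ (β_ D D).inv) ▷ (X ⊗ X) ≫ nestedEval X D
      rw [whiskerLeft_comp_assoc, h.pair_mul, whisker_exchange_assoc, ← braiding_inv_nestedEval,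
        comp_whiskerRight_assoc])
    h.one_pair h.pair_one

variable [IsIso 𝒮[D]]

/-- The right action `x σ = S⁻¹(σ) x` of `D` on `X`, formed with the inverse braiding. -/
noncomputable def invAntipodeAction (X D : C) [ComonObj X] [HopfObj D] [ExactPairing X D]
    [IsIso 𝒮[D]] : X ⊗ D ⟶ X :=
  (β_ D X).inv ≫ inv 𝒮[D] ▷ X ≫ action X D

/-- The coaction `x ↦ φ x ⊗ ε` of `D` on `X`, where `φ ⊗ ε` is the canonical element of `X ⊗ D`
and `x` is moved past `φ` by the inverse braiding. -/
def leftMulCoaction (X D : C) [MonObj X] [ExactPairing X D] : X ⟶ X ⊗ D :=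
  (ρ_ X).inv ≫ X ◁ η_ X D ≫ (α_ X X D).inv ≫ ((β_ X X).inv ≫ μ[X]) ▷ D

lemma IsHopfDual.isHopfModule_op (h : IsHopfDual X D) :
    @IsHopfModule C _ _ (reverseBraiding C) X D (copHopfObj D) (invAntipodeAction X D)
      (leftMulCoaction X D) :=
  @isHopfModule_coevCoaction C _ _ (reverseBraiding C) X D (opMonObj X) _ (copHopfObj D) _
    h.isDualPair_op

lemma braidedIntegral_eq_coinvProj : braidedIntegral X D =
    @coinvProj C _ _ (reverseBraiding C) X D (copHopfObj D) (invAntipodeAction X D)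
      (leftMulCoaction X D) := by
  change _ = leftMulCoaction X D ≫ X ◁ inv 𝒮[D] ≫ invAntipodeAction X D
  symm
  calc
    _ = 𝟙 _ ⊗≫ X ◁ η_ X D ⊗≫ (β_ X X).inv ▷ D ⊗≫ (μ[X] ▷ D ≫ (β_ D X).inv) ≫
        (inv 𝒮[D] ≫ inv 𝒮[D]) ▷ X ≫ action X D := by
      rw [leftMulCoaction, invAntipodeAction,
        BraidedCategory.braiding_inv_naturality_right_assoc]
      monoidal
    _ = 𝟙 _ ⊗≫ (X ◁ η_ X D ≫ (β_ (X ⊗ D) X).inv) ⊗≫ (β_ D X).inv ▷ X ⊗≫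
        (D ◁ μ[X] ≫ (inv 𝒮[D] ≫ inv 𝒮[D]) ▷ X) ≫ action X D := by
      rw [BraidedCategory.braiding_inv_naturality_left]
      simp only [BraidedCategory.braiding_tensor_left_inv,
        BraidedCategory.braiding_tensor_right_inv]
      monoidal
    _ = 𝟙 _ ⊗≫ (β_ (𝟙_ C) X).inv ⊗≫ (η_ X D ≫ (β_ D X).inv) ▷ X ⊗≫
        inv (𝒮[D] ≫ 𝒮[D]) ▷ (X ⊗ X) ≫ D ◁ μ[X] ≫ action X D := by
      rw [BraidedCategory.braiding_inv_naturality_right, whisker_exchange, IsIso.inv_comp]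
      monoidal
    _ = _ := by
      rw [braiding_inv_tensorUnit_left, braidedIntegral, twistedCoev]
      monoidal

lemma IsHopfDual.action_braidedIntegral (h : IsHopfDual X D) :
    action X D ≫ braidedIntegral X D = ε[D] ▷ X ≫ (λ_ X).hom ≫ braidedIntegral X D := by
  have invariant : invAntipodeAction X D ≫ braidedIntegral X D =
      X ◁ ε[D] ≫ (ρ_ X).hom ≫ braidedIntegral X D := by
    rw [braidedIntegral_eq_coinvProj]
    exact @IsHopfModule.action_coinvProj C _ _ (reverseBraiding C) X D (copHopfObj D) _ _
      h.isHopfModule_op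
  have inv_antipode_counit : inv 𝒮[D] ≫ ε[D] = ε[D] := by
    rw [IsIso.inv_comp_eq, HopfObj.antipode_counit]
  rw [← cancel_epi (inv 𝒮[D] ▷ X), ← cancel_epi (β_ D X).inv]
  calc
    _ = invAntipodeAction X D ≫ braidedIntegral X D := by
      simp only [invAntipodeAction, Category.assoc]
    _ = (β_ D X).inv ≫ ε[D] ▷ X ≫ (λ_ X).hom ≫ braidedIntegral X D := by
      rw [invariant, ← BraidedCategory.braiding_inv_naturality_right_assoc,
        braiding_inv_tensorUnit_left_assoc]
      simp
    _ = _ := by rw [← comp_whiskerRight_assoc, inv_antipode_counit]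

lemma IsHopfDual.whiskerLeft_braidedIntegral_mul (h : IsHopfDual X D) :
    X ◁ braidedIntegral X D ≫ μ[X] = ε[X] ▷ X ≫ (λ_ X).hom ≫ braidedIntegral X D := by
  have coinvariant : braidedIntegral X D ≫ leftMulCoaction X D =
      braidedIntegral X D ≫ (ρ_ X).inv ≫ X ◁ η[D] := by
    rw [braidedIntegral_eq_coinvProj]
    exact @IsHopfModule.coinvProj_coaction C _ _ (reverseBraiding C) X D (copHopfObj D) _ _
      h.isHopfModule_op
  rw [← cancel_epi (β_ X X).inv]
  calc
    _ = braidedIntegral X D ▷ X ≫ (β_ X X).inv ≫ μ[X] := by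
      rw [BraidedCategory.braiding_inv_naturality_left_assoc]
    _ = braidedIntegral X D ▷ X ⊗≫ X ◁ (η_ X D ▷ X ⊗≫ X ◁ ε_ X D) ⊗≫ (β_ X X).inv ≫ μ[X] := by
      rw [ExactPairing.evaluation_coevaluation'']; monoidal
    _ = braidedIntegral X D ▷ X ⊗≫ X ◁ η_ X D ▷ X ⊗≫
        ((X ⊗ X) ◁ ε_ X D ≫ ((β_ X X).inv ≫ μ[X]) ▷ 𝟙_ C) ⊗≫ 𝟙 _ := by
      monoidal
    _ = (braidedIntegral X D ≫ leftMulCoaction X D) ▷ X ⊗≫ X ◁ ε_ X D ⊗≫ 𝟙 _ := by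
      rw [whisker_exchange, leftMulCoaction]; monoidal
    _ = (braidedIntegral X D ▷ X ≫ X ◁ ((λ_ X).inv ≫ η[D] ▷ X ≫ ε_ X D)) ≫ (ρ_ X).hom := by
      rw [coinvariant]; monoidal
    _ = X ◁ ε[X] ≫ (ρ_ X).hom ≫ braidedIntegral X D := by
      rw [h.one_pair, Iso.inv_hom_id_assoc, ← whisker_exchange]; monoidal
    _ = _ := by
      rw [← BraidedCategory.braiding_inv_naturality_right_assoc,
        braiding_inv_tensorUnit_left_assoc, Iso.inv_hom_id_assoc]

lemma IsHopfDual.exists_section (h : IsHopfDual X D) :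
    ∃ (a : X ⊗ D ⟶ X) (c : X ⟶ X ⊗ D), c ≫ braidedIntegral X D ▷ D ≫ a = 𝟙 X ∧
      braidedIntegral X D ▷ D ≫ a ≫ c ≫ braidedIntegral X D ▷ D = braidedIntegral X D ▷ D := by
  refine ⟨invAntipodeAction X D, leftMulCoaction X D, ?_⟩
  rw [braidedIntegral_eq_coinvProj]
  exact ⟨@IsHopfModule.coaction_coinvProj_action C _ _ (reverseBraiding C) X D (copHopfObj D) _ _
      h.isHopfModule_op,
    @IsHopfModule.coinvProj_action_coaction_coinvProj C _ _ (reverseBraiding C) X D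
      (copHopfObj D) _ _ h.isHopfModule_op⟩

end Reversal

section Contraction

variable {R M N P : Type*} [CommSemiring R] [AddCommMonoid M] [Module R M] [AddCommMonoid N]
  [Module R N] [AddCommMonoid P] [Module R P]

lemma apply_rid_lTensor (f : M →ₗ[R] R) (g : N →ₗ[R] R) (t : M ⊗[R] N) :
    f (TensorProduct.rid R M (g.lTensor M t)) = g (TensorProduct.lid R N (f.rTensor N t)) := by
  induction t with
  | zero => simp
  | tmul a b => simp [mul_comm]
  | add a b ha hb => simp only [map_add, ha, hb]

lemma rid_lTensor_assoc_tmul (e : N ⊗[R] P →ₗ[R] R) (t : M ⊗[R] N) (x : P) :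
    TensorProduct.rid R M (e.lTensor M (TensorProduct.assoc R M N P (t ⊗ₜ x))) =
      TensorProduct.rid R M (((TensorProduct.curry e).flip x).lTensor M t) := by
  induction t with
  | zero => simp
  | tmul a b => simp
  | add a b ha hb => simp only [TensorProduct.add_tmul, map_add, ha, hb]

lemma lid_rTensor_assoc_symm_tmul (e : P ⊗[R] M →ₗ[R] R) (s : P) (t : M ⊗[R] N) :
    TensorProduct.lid R N (e.rTensor N ((TensorProduct.assoc R P M N).symm (s ⊗ₜ t))) =
      TensorProduct.lid R N ((TensorProduct.curry e s).rTensor N t) := by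
  induction t with
  | zero => simp
  | tmul a b => simp
  | add a b ha hb => simp only [TensorProduct.tmul_add, map_add, ha, hb]

end Contraction

section RankOne

variable {k V V' W : Type*} [Field k] [AddCommGroup V] [Module k V] [AddCommGroup V'] [Module k V']
  [AddCommGroup W] [Module k W]

lemma finrank_range_rTensor (φ : V →ₗ[k] V') :
    Module.finrank k (LinearMap.range (φ.rTensor W)) =
      Module.finrank k (LinearMap.range φ) * Module.finrank k W := by
  have factor : φ.rTensor W = (LinearMap.range φ).subtype.rTensor W ∘ₗ
      φ.rangeRestrict.rTensor W := by
    rw [← LinearMap.rTensor_comp, LinearMap.subtype_comp_codRestrict]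
  have surj : LinearMap.range (φ.rangeRestrict.rTensor W) = ⊤ :=
    LinearMap.range_eq_top.2 (LinearMap.rTensor_surjective W φ.surjective_rangeRestrict)
  have inj : Function.Injective ((LinearMap.range φ).subtype.rTensor W) :=
    Module.Flat.rTensor_preserves_injective_linearMap _ (Submodule.subtype_injective _)
  rw [factor, LinearMap.range_comp_of_range_eq_top _ surj, LinearMap.finrank_range_of_inj inj,
    Module.finrank_tensorProduct]

-- The hypotheses identify `V` with the range of `φ ⊗ W`, whose dimension is `rank φ * dim W`.
lemma finrank_range_eq_one {φ : V →ₗ[k] V'} {a : V' ⊗[k] W →ₗ[k] V} {c : V →ₗ[k] V ⊗[k] W}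
    (hV : 0 < Module.finrank k V) (hW : Module.finrank k W = Module.finrank k V)
    (section_eq : ∀ x, a (φ.rTensor W (c x)) = x)
    (retract_eq : ∀ t, φ.rTensor W (c (a (φ.rTensor W t))) = φ.rTensor W t) :
    Module.finrank k (LinearMap.range φ) = 1 := by
  have range_eq : LinearMap.range (φ.rTensor W ∘ₗ c) = LinearMap.range (φ.rTensor W) :=
    le_antisymm (LinearMap.range_comp_le_range _ _) fun _ ⟨t, ht⟩ =>
      ⟨a (φ.rTensor W t), (retract_eq t).trans ht⟩
  have inj : Function.Injective (φ.rTensor W ∘ₗ c) :=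
    Function.LeftInverse.injective (g := a) section_eq
  have h := LinearMap.finrank_range_of_inj inj
  rw [range_eq, finrank_range_rTensor, hW] at h
  exact Nat.eq_of_mul_eq_mul_right hV (h.trans (one_mul _).symm)

lemma exists_eq_smul_of_finrank_range_eq_one {φ : V →ₗ[k] V'}
    (hφ : Module.finrank k (LinearMap.range φ) = 1) :
    ∃ (f : V →ₗ[k] k) (v : V), φ v ≠ 0 ∧ ∀ x, φ x = f x • φ v := by
  have : Module.Finite k (LinearMap.range φ) := Module.finite_of_finrank_eq_succ hφ
  let e : LinearMap.range φ ≃ₗ[k] k :=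
    LinearEquiv.ofFinrankEq _ _ (hφ.trans (Module.finrank_self k).symm)
  obtain ⟨⟨_, v, rfl⟩, hv⟩ := e.surjective 1
  refine ⟨e ∘ₗ φ.rangeRestrict, v, fun h => ?_, fun x => ?_⟩
  · simp_rw [h] at hv
    exact zero_ne_one ((map_zero e).symm.trans hv)
  · have := e.injective (a₁ := φ.rangeRestrict x) (a₂ := e (φ.rangeRestrict x) • ⟨φ v, v, rfl⟩)
      (by simp [hv])
    exact congrArg Subtype.val this

end RankOne

section Pairing

open Functor.Monoidal

variable {k : Type u} [Field k] {C : Type w} [Category.{v} C] [MonoidalCategory C]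
  (F : C ⥤ ModuleCat.{u} k) [F.Monoidal]

/-- The exact pairing of underlying vector spaces induced by an exact pairing; its evaluation is
the uncurried `pairing`. -/
abbrev mapExactPairing (X D : C) [ExactPairing X D] : ExactPairing (F.obj X) (F.obj D) where
  coevaluation' := Functor.LaxMonoidal.ε F ≫ F.map (η_ X D) ≫ Functor.OplaxMonoidal.δ F X D
  evaluation' := Functor.LaxMonoidal.μ F D X ≫ F.map (ε_ X D) ≫ Functor.OplaxMonoidal.η F
  coevaluation_evaluation' := by
    have e := congrArg (fun f => F.map ((ρ_ D).inv ≫ f ≫ (λ_ D).hom))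
      (ExactPairing.coevaluation_evaluation X D)
    simp only [Functor.map_comp, map_whiskerLeft, map_whiskerRight, map_associator_inv,
      map_leftUnitor, map_rightUnitor_inv, Category.assoc, μ_δ_assoc, Category.comp_id,
      Iso.inv_hom_id, CategoryTheory.Functor.map_id] at e
    rw [← cancel_epi (ρ_ (F.obj D)).inv, ← cancel_mono (λ_ (F.obj D)).hom]
    simpa using e
  evaluation_coevaluation' := by
    have e := congrArg (fun f => F.map ((λ_ X).inv ≫ f ≫ (ρ_ X).hom))
      (ExactPairing.evaluation_coevaluation X D)
    simp only [Functor.map_comp, map_whiskerLeft, map_whiskerRight, map_associator,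
      map_leftUnitor_inv, map_rightUnitor, Category.assoc, μ_δ_assoc, Category.comp_id,
      Iso.inv_hom_id, CategoryTheory.Functor.map_id] at e
    rw [← cancel_epi (λ_ (F.obj X)).inv, ← cancel_mono (ρ_ (F.obj X)).hom]
    simpa using e

attribute [local instance] mapExactPairing

lemma mapExactPairing_evaluation (X D : C) [ExactPairing X D] :
    ε_ (F.obj X) (F.obj D) =
      Functor.LaxMonoidal.μ F D X ≫ F.map (ε_ X D) ≫ Functor.OplaxMonoidal.η F := rfl

section ExactPairing

variable (X D : C) [ExactPairing X D]

lemma rid_lTensor_coevaluation (x : F.obj X) : TensorProduct.rid k (F.obj X)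
    (((pairing F X D).flip x).lTensor (F.obj X) ((η_ (F.obj X) (F.obj D)).hom (1 : k))) = x := by
  refine (rid_lTensor_assoc_tmul _ _ _).symm.trans ?_
  have e : (λ_ (F.obj X)).inv ≫ η_ (F.obj X) (F.obj D) ▷ F.obj X ≫ (α_ _ _ _).hom ≫
      F.obj X ◁ ε_ (F.obj X) (F.obj D) ≫ (ρ_ (F.obj X)).hom = 𝟙 _ := by simp
  exact congrArg (fun f => f.hom x) e

lemma lid_rTensor_coevaluation (s : F.obj D) : TensorProduct.lid k (F.obj D)
    ((pairing F X D s).rTensor (F.obj D) ((η_ (F.obj X) (F.obj D)).hom (1 : k))) = s := by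
  refine (lid_rTensor_assoc_symm_tmul _ _ _).symm.trans ?_
  have e : (ρ_ (F.obj D)).inv ≫ F.obj D ◁ η_ (F.obj X) (F.obj D) ≫ (α_ _ _ _).inv ≫
      ε_ (F.obj X) (F.obj D) ▷ F.obj D ≫ (λ_ (F.obj D)).hom = 𝟙 _ := by simp
  exact congrArg (fun f => f.hom s) e

lemma finite_obj (X D : C) [ExactPairing X D] : Module.Finite k (F.obj X) := by
  obtain ⟨s, hs⟩ := TensorProduct.exists_finset ((η_ (F.obj X) (F.obj D)).hom (1 : k))
  classical
  refine ⟨⟨s.image Prod.fst, eq_top_iff.2 ?_⟩⟩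
  rintro x -
  rw [← rid_lTensor_coevaluation F X D x, hs, map_sum, map_sum]
  refine Submodule.sum_mem _ fun i hi => ?_
  rw [LinearMap.lTensor_tmul, TensorProduct.rid_tmul]
  exact Submodule.smul_mem _ _ (Submodule.subset_span (by simpa using ⟨_, hi⟩))

lemma pairing_bijective : Function.Bijective (pairing F X D) := by
  refine ⟨fun s t h => ?_, fun f => ⟨TensorProduct.lid k _
    (f.rTensor (F.obj D) ((η_ (F.obj X) (F.obj D)).hom (1 : k))), LinearMap.ext fun x => ?_⟩⟩
  · rw [← lid_rTensor_coevaluation F X D s, h, lid_rTensor_coevaluation]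
  · rw [← LinearMap.flip_apply, ← apply_rid_lTensor, rid_lTensor_coevaluation]

lemma pairing_flip_injective : Function.Injective (pairing F X D).flip := fun x y h => by
  rw [← rid_lTensor_coevaluation F X D x, h, rid_lTensor_coevaluation]

lemma finrank_obj_dual : Module.finrank k (F.obj D) = Module.finrank k (F.obj X) :=
  (LinearEquiv.ofBijective _ (pairing_bijective F X D)).finrank_eq.trans Subspace.dual_finrank_eq

end ExactPairing

/-- The bilinear map on underlying vector spaces induced by a morphism `A ⊗ B ⟶ Y`. -/
def bilin {A B Y : C} (f : A ⊗ B ⟶ Y) : F.obj A →ₗ[k] F.obj B →ₗ[k] F.obj Y :=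
  TensorProduct.curry (Functor.LaxMonoidal.μ F A B ≫ F.map f).hom

/-- The counit on the underlying vector space. -/
def counitLin (A : C) [ComonObj A] : F.obj A →ₗ[k] k :=
  (F.map ε[A] ≫ Functor.OplaxMonoidal.η F).hom

lemma bilin_comp {A B Y Z : C} (f : A ⊗ B ⟶ Y) (g : Y ⟶ Z) (a : F.obj A) (b : F.obj B) :
    bilin F (f ≫ g) a b = (F.map g).hom (bilin F f a b) := by
  simp [bilin]

lemma bilin_whiskerLeft_comp {A B B' Y : C} (g : B ⟶ B') (f : A ⊗ B' ⟶ Y) (a : F.obj A)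
    (b : F.obj B) : bilin F (A ◁ g ≫ f) a b = bilin F f a ((F.map g).hom b) := by
  have e : Functor.LaxMonoidal.μ F A B ≫ F.map (A ◁ g ≫ f) =
      F.obj A ◁ F.map g ≫ Functor.LaxMonoidal.μ F A B' ≫ F.map f := by simp
  exact congrArg (fun t => t.hom (a ⊗ₜ[k] b)) e

lemma bilin_counit_whiskerRight_comp {A B Y : C} [ComonObj A] (f : B ⟶ Y) (a : F.obj A)
    (b : F.obj B) :
    bilin F (ε[A] ▷ B ≫ (λ_ B).hom ≫ f) a b = counitLin F A a • (F.map f).hom b := by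
  have e : Functor.LaxMonoidal.μ F A B ≫ F.map (ε[A] ▷ B ≫ (λ_ B).hom ≫ f) =
      (F.map ε[A] ≫ Functor.OplaxMonoidal.η F) ▷ F.obj B ≫ (λ_ (F.obj B)).hom ≫ F.map f := by
    simp
  exact (congrArg (fun t => t.hom (a ⊗ₜ[k] b)) e).trans
    ((F.map f).hom.map_smul (counitLin F A a) b)

lemma bilin_action (X D : C) [ExactPairing X D] [ComonObj X] (s : F.obj D) (x : F.obj X) :
    bilin F (action X D) s x =
      TensorProduct.lid k (F.obj X) ((pairing F X D s).rTensor (F.obj X) (comulLin F X x)) := by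
  have e : Functor.LaxMonoidal.μ F D X ≫ F.map (action X D) =
      F.obj D ◁ (F.map Δ[X] ≫ Functor.OplaxMonoidal.δ F X X) ≫ (α_ _ _ _).inv ≫
        ε_ (F.obj X) (F.obj D) ▷ F.obj X ≫ (λ_ (F.obj X)).hom := by
    simp only [mapExactPairing_evaluation, action, Functor.map_comp, map_whiskerLeft,
      map_whiskerRight, map_associator_inv, map_leftUnitor, Category.assoc, μ_δ_assoc,
      comp_whiskerRight, whiskerLeft_comp]
  refine (congrArg (fun t => t.hom (s ⊗ₜ[k] x)) e).trans ?_
  exact lid_rTensor_assoc_symm_tmul _ _ _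

lemma counitLin_oneElt (X : C) [BraidedCategory C] [BimonObj X] :
    counitLin F X (oneElt F X) = 1 := by
  have e : (Functor.LaxMonoidal.ε F ≫ F.map η[X]) ≫ F.map ε[X] ≫ Functor.OplaxMonoidal.η F =
      𝟙 _ := by
    rw [Category.assoc, ← F.map_comp_assoc, BimonObj.one_counit, CategoryTheory.Functor.map_id,
      Category.id_comp, Functor.Monoidal.ε_η]
  exact congrArg (fun t => t.hom (1 : k)) e

lemma finrank_obj_pos (X D : C) [ExactPairing X D] [BraidedCategory C] [BimonObj X] :
    0 < Module.finrank k (F.obj X) := by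
  have := finite_obj F X D
  have : Nontrivial (F.obj X) := ⟨oneElt F X, 0, fun h => by
    simpa [h] using counitLin_oneElt F X⟩
  exact Module.finrank_pos

lemma map_nestedEval (X D : C) [ExactPairing X D] :
    Functor.LaxMonoidal.μ F (D ⊗ D) (X ⊗ X) ≫ F.map (nestedEval X D) ≫
        Functor.OplaxMonoidal.η F =
      (Functor.OplaxMonoidal.δ F D D ⊗ₘ Functor.OplaxMonoidal.δ F X X) ≫
        nestedEval (F.obj X) (F.obj D) := by
  simp only [mapExactPairing_evaluation, nestedEval, Functor.map_comp, map_whiskerLeft,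
    map_whiskerRight, map_associator, map_associator_inv, map_leftUnitor, Category.assoc,
    μ_δ_assoc, comp_whiskerRight, whiskerLeft_comp, whiskerLeft_μ_δ_assoc,
    MonoidalCategory.tensorHom_def]
  rw [← associator_naturality_right_assoc]

lemma nestedEval_tmul (X D : C) [ExactPairing X D] (t : F.obj D ⊗[k] F.obj D) (x y : F.obj X) :
    (nestedEval (F.obj X) (F.obj D)).hom (t ⊗ₜ[k] (x ⊗ₜ[k] y)) =
      pairing F X D (TensorProduct.lid k (F.obj D)
        (((pairing F X D).flip y).rTensor (F.obj D) t)) x := by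
  induction t with
  | zero => simp
  | tmul a b =>
    change pairing F X D a (pairing F X D b x • y) = pairing F X D (pairing F X D a y • b) x
    simp [mul_comm]
  | add a b ha hb => simp only [TensorProduct.add_tmul, map_add, ha, hb, LinearMap.add_apply]

namespace IsDualPair

variable {X D : C} [MonObj X] [ComonObj X] [MonObj D] [ComonObj D] [ExactPairing X D]

lemma pairing_oneElt (h : IsDualPair X D) (s : F.obj D) :
    pairing F X D s (oneElt F X) = counitLin F D s := by
  have e : (ρ_ (F.obj D)).inv ≫ F.obj D ◁ (Functor.LaxMonoidal.ε F ≫ F.map η[X]) ≫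
      Functor.LaxMonoidal.μ F D X ≫ F.map (ε_ X D) ≫ Functor.OplaxMonoidal.η F =
      F.map ε[D] ≫ Functor.OplaxMonoidal.η F := by
    have e := congrArg (fun t => F.map ((ρ_ D).inv ≫ t) ≫ Functor.OplaxMonoidal.η F) h.pair_one
    simp only [Functor.map_comp, map_whiskerLeft, map_rightUnitor_inv, Category.assoc, μ_δ_assoc,
      Iso.inv_hom_id_assoc] at e
    simpa only [comp_whiskerRight, whiskerLeft_comp, Category.assoc] using e
  exact congrArg (fun t => t.hom s) e

lemma oneElt_pairing (h : IsDualPair X D) (x : F.obj X) :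
    pairing F X D (oneElt F D) x = counitLin F X x := by
  have e : (λ_ (F.obj X)).inv ≫ (Functor.LaxMonoidal.ε F ≫ F.map η[D]) ▷ F.obj X ≫
      Functor.LaxMonoidal.μ F D X ≫ F.map (ε_ X D) ≫ Functor.OplaxMonoidal.η F =
      F.map ε[X] ≫ Functor.OplaxMonoidal.η F := by
    have e := congrArg (fun t => F.map ((λ_ X).inv ≫ t) ≫ Functor.OplaxMonoidal.η F) h.one_pair
    simp only [Functor.map_comp, map_whiskerRight, map_leftUnitor_inv, Category.assoc, μ_δ_assoc,
      Iso.inv_hom_id_assoc] at e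
    simpa only [comp_whiskerRight, whiskerLeft_comp, Category.assoc] using e
  exact congrArg (fun t => t.hom x) e

lemma pairing_mul (h : IsDualPair X D) (s : F.obj D) (x y : F.obj X) :
    pairing F X D s (bilin F μ[X] x y) = pairing F X D (TensorProduct.lid k (F.obj D)
      (((pairing F X D).flip y).rTensor (F.obj D) (comulLin F D s))) x := by
  have e : F.obj D ◁ (Functor.LaxMonoidal.μ F X X ≫ F.map μ[X]) ≫ ε_ (F.obj X) (F.obj D) =
      (F.map Δ[D] ≫ Functor.OplaxMonoidal.δ F D D) ▷ (F.obj X ⊗ F.obj X) ≫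
        nestedEval (F.obj X) (F.obj D) := by
    calc
      _ = F.obj D ◁ Functor.LaxMonoidal.μ F X X ≫ Functor.LaxMonoidal.μ F D (X ⊗ X) ≫
          F.map (D ◁ μ[X] ≫ ε_ X D) ≫ Functor.OplaxMonoidal.η F := by
        rw [mapExactPairing_evaluation]
        simp
      _ = F.obj D ◁ Functor.LaxMonoidal.μ F X X ≫ F.map Δ[D] ▷ F.obj (X ⊗ X) ≫
          Functor.LaxMonoidal.μ F (D ⊗ D) (X ⊗ X) ≫ F.map (nestedEval X D) ≫
          Functor.OplaxMonoidal.η F := by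
        rw [h.pair_mul]
        simp
      _ = _ := by
        rw [map_nestedEval, tensorHom_def'_assoc, whisker_exchange_assoc,
          ← whiskerLeft_comp_assoc, μ_δ]
        simp
  refine (congrArg (fun t => t.hom (s ⊗ₜ[k] (x ⊗ₜ[k] y))) e).trans ?_
  exact nestedEval_tmul F X D _ x y

lemma isRightIntegral_flip_pairing (h : IsDualPair X D) {δ : F.obj X}
    (hδ : ∀ x, bilin F μ[X] x δ = counitLin F X x • δ) :
    IsRightIntegral F D ((pairing F X D).flip δ) := fun s => by
  refine (pairing_bijective F X D).1 (LinearMap.ext fun x => ?_)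
  rw [← h.pairing_mul F, hδ, map_smul, map_smul, LinearMap.smul_apply, h.oneElt_pairing F,
    LinearMap.flip_apply, smul_eq_mul, smul_eq_mul, mul_comm]

lemma isLeftIntegral_of_bilin_action (h : IsDualPair X D) {L : F.obj X →ₗ[k] k}
    (hL : ∀ s x, L (bilin F (action X D) s x) = counitLin F D s * L x) :
    IsLeftIntegral F X L := fun x => by
  refine pairing_flip_injective F X D (LinearMap.ext fun s => ?_)
  rw [LinearMap.flip_apply, LinearMap.flip_apply, apply_rid_lTensor, ← bilin_action, hL, map_smul,
    h.pairing_oneElt F, smul_eq_mul, mul_comm]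

end IsDualPair

end Pairing

section Integral

open Functor.Monoidal

variable {k : Type u} [Field k] {C : Type w} [Category.{v} C] [MonoidalCategory C]
  [BraidedCategory C] (F : C ⥤ ModuleCat.{u} k) [F.Monoidal]
  {X D : C} [HopfObj X] [HopfObj D] [ExactPairing X D]

namespace IsHopfDual

lemma isDualPair (h : IsHopfDual X D) : IsDualPair X D :=
  ⟨h.mul_pair, h.pair_mul, h.one_pair, h.pair_one⟩

variable [IsIso 𝒮[D]]

lemma finrank_range_braidedIntegral (h : IsHopfDual X D) :
    Module.finrank k (LinearMap.range (F.map (braidedIntegral X D)).hom) = 1 := by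
  obtain ⟨a, c, section_eq, retract_eq⟩ := h.exists_section
  have e₁ : (F.map c ≫ Functor.OplaxMonoidal.δ F X D) ≫ F.map (braidedIntegral X D) ▷ F.obj D ≫
      Functor.LaxMonoidal.μ F X D ≫ F.map a = 𝟙 _ := by
    simpa using congrArg F.map section_eq
  have e₂ : F.map (braidedIntegral X D) ▷ F.obj D ≫ (Functor.LaxMonoidal.μ F X D ≫ F.map a) ≫
      (F.map c ≫ Functor.OplaxMonoidal.δ F X D) ≫ F.map (braidedIntegral X D) ▷ F.obj D =
      F.map (braidedIntegral X D) ▷ F.obj D := by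
    simpa only [Functor.map_comp, map_whiskerRight, Category.assoc, μ_δ, μ_δ_assoc,
      Category.comp_id] using congrArg (fun t => Functor.LaxMonoidal.μ F X D ≫ F.map t ≫
        Functor.OplaxMonoidal.δ F X D) retract_eq
  exact finrank_range_eq_one (finrank_obj_pos F X D) (finrank_obj_dual F X D)
    (fun x => congrArg (fun t => t.hom x) e₁) (fun t => congrArg (fun f => f.hom t) e₂)

lemma mul_braidedIntegral (h : IsHopfDual X D) (x y : F.obj X) :
    bilin F μ[X] x ((F.map (braidedIntegral X D)).hom y) =
      counitLin F X x • (F.map (braidedIntegral X D)).hom y := by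
  rw [← bilin_whiskerLeft_comp, h.whiskerLeft_braidedIntegral_mul, bilin_counit_whiskerRight_comp]

lemma braidedIntegral_action (h : IsHopfDual X D) (s : F.obj D) (x : F.obj X) :
    (F.map (braidedIntegral X D)).hom (bilin F (action X D) s x) =
      counitLin F D s • (F.map (braidedIntegral X D)).hom x := by
  rw [← bilin_comp, h.action_braidedIntegral, bilin_counit_whiskerRight_comp]

end IsHopfDual

end Integral

end BraidedIntegral

open BraidedIntegral in
theorem lemma6 {k : Type u} [Field k] {C : Type w} [Category.{v} C] [MonoidalCategory C]
    [BraidedCategory C] (F : C ⥤ ModuleCat.{u} k) [F.Monoidal]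
    (X D : C) [HopfObj X] [HopfObj D] [ExactPairing X D]
    (hXD : BraidedIntegral.IsHopfDual X D) [IsIso 𝒮[D]] :
    F.map (BraidedIntegral.braidedIntegral X D) ≠ 0 ∧
    ∃ (R : F.obj D →ₗ[k] k) (δ : F.obj X) (L : F.obj X →ₗ[k] k),
      BraidedIntegral.IsRightDelta F X D R δ ∧
      BraidedIntegral.IsLeftIntegral F X L ∧ L ≠ 0 ∧
      ∀ x : F.obj X, (F.map (BraidedIntegral.braidedIntegral X D)).hom x = L x • δ := by
  obtain ⟨L, y, hδ, hI⟩ :=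
    exists_eq_smul_of_finrank_range_eq_one (hXD.finrank_range_braidedIntegral F)
  set δ := (F.map (braidedIntegral X D)).hom y with hδ_def
  have right : IsRightIntegral F D ((pairing F X D).flip δ) :=
    hXD.isDualPair.isRightIntegral_flip_pairing F fun x => hXD.mul_braidedIntegral F x y
  have left : IsLeftIntegral F X L :=
    hXD.isDualPair.isLeftIntegral_of_bilin_action F fun s x => smul_left_injective k hδ <| by
      simpa only [hI, mul_smul] using hXD.braidedIntegral_action F s x
  refine ⟨fun h => hδ ?_, (pairing F X D).flip δ, δ, L, ⟨right, fun h => hδ ?_, fun _ => rfl⟩,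
    left, fun h => hδ ?_, hI⟩
  · rw [hδ_def, h]; rfl
  · exact pairing_flip_injective F X D (h.trans (map_zero _).symm)
  · rw [hδ_def, hI, h, LinearMap.zero_apply, zero_smul]
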